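/- Let $d\ge 1$ and let $X=(X_t)_{t\ge0}$ be an ergodic, temporally homogeneous Markov process on $\mathbb R^d$ (with jointly measurable paths) with invariant probability measure $\mu$. Let $P_tf(x)=\mathbb E^x[f(X_t)]$ be its transition semigroup, strongly continuous on $L^2(\mu)$, and let $\mathcal L$ with domain $\mathscr D(\mathcal L)$ be its infinitesimal generator on $L^2(\mu)$. Assume the iterated Poincaré inequality (H2): there is a constant $\lambda_{\mathrm I}>0$ such that $$\|\mathcal Lf\|_{L^2(\mu)}\ \ge\ \lambda_{\mathrm I}\,\|f\|_{L^2(\mu)}\qquad\text{for all } f\in\mathscr D(\mathcal L)\text{ with }\mu(f)=0 .$$ Let $p>0$, and assume that $\int_{\mathbb R^d}|x|^q\,\mu(\mathrm dx)<\infty$ for some $q>p$. For $T>0$ let $\mu_T:=\frac1T\int_0^T\delta_{X_t}\,\mathrm dt$ be the empirical measure. For probability measures $\nu_0,\nu_1$ on $\mathbb R^d$ let $$\mathcal T_p(\nu_0,\nu_1):=\inf_\pi\int|x-y|^p\,\pi(\mathrm dx,\mathrm dy),$$ where the infimum is over all couplings $\pi$ of $\nu_0$ and $\nu_1$. Let $\mathbb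 E^\mu$ be the expectation for the process with initial law $\mu$. Define $$\gamma_1:=\max\Big\{\tfrac14,\ 1-\tfrac pd\Big\}\in(0,1).$$ Then there exists a constant $C>0$ such that for all $T\ge2$, $$\mathbb E^\mu[\mathcal T_p(\mu_T,\mu)]\ \le\ C\,T^{-\frac23\left(1-\max\{\gamma_1,\,p/q\}\right)}\big(\mathbf 1_{\{\gamma_1q=p\}}\log T+\mathbf 1_{\{\gamma_1q\ne p\}}\big)\big(\mathbf 1_{\{p=\frac34d\}}\log T+\mathbf 1_{\{p\ne\frac34d\}}\big).$$ In particular, if $q>4p$, then for all $T\ge 2$ $$\mathbb E^\mu[\mathcal T_p(\mu_T,\mu)]\ \le\ \begin{cases} C\,T^{-1/2} & \text{if } p>\frac34d,\\ C\,T^{-1/2}\log T & \text{if } p=\frac34d,\\ C\,T^{-2p/(3d)} & \text{if } p<\frac34d.\end{cases}$$ -/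

import Mathlib

open MeasureTheory ProbabilityTheory Filter Topology
open scoped NNReal ENNReal

noncomputable section

/-- A temporally homogeneous Markov process `(X_t)_{t ≥ 0}` with state space `E`, realised on a
measurable space `Ω` carrying the probabilities `P^x`, `x ∈ E`, under which it starts at `x`.
The paths are jointly measurable in time and chance, so that time integrals along the paths make
sense. -/
structure MarkovProcess (E : Type*) [MeasurableSpace E] (Ω : Type*) [MeasurableSpace Ω] where
  /-- The position `X_t(ω)`. -/
  path : ℝ≥0 → Ω → E
  measurable_path : Measurable (fun z : ℝ≥0 × Ω => path z.1 z.2)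
  /-- The family `(P^x)`, measurable in `x`. -/
  prob : Kernel E Ω
  isMarkovKernel : IsMarkovKernel prob
  /-- `X_0 = x` holds `P^x`-almost surely. -/
  start : ∀ x, ∀ᵐ ω ∂(prob x), path 0 ω = x
  /-- The Markov property `P^x(X_{s+t} ∈ A | F_s) = P^{X_s}(X_t ∈ A)`, where
  `F_s = σ(X_r : r ≤ s)`, with the conditional probability spelt out on the events `B ∈ F_s`. -/
  markov : ∀ (x : E) (s t : ℝ≥0) (A : Set E), MeasurableSet A → ∀ B : Set Ω,
    MeasurableSet[⨆ r ≤ s, MeasurableSpace.comap (path r) inferInstance] B →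
    prob x (B ∩ path (s + t) ⁻¹' A) =
      ∫⁻ ω in B, prob (path s ω) (path t ⁻¹' A) ∂(prob x)

namespace MarkovProcess

variable {E : Type*} [MeasurableSpace E] {Ω : Type*} [MeasurableSpace Ω]

/-- The transition kernel `p_t(x, A) = P^x(X_t ∈ A)`. -/
def transition (X : MarkovProcess E Ω) (t : ℝ≥0) : Kernel E E := X.prob.map (X.path t)

/-- The transition operator `P_t f (x) = E^x[f(X_t)]`. -/
def semigroup (X : MarkovProcess E Ω) (t : ℝ≥0) (f : E → ℝ) (x : E) : ℝ :=
  ∫ ω, f (X.path t ω) ∂(X.prob x)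

/-- The probability `P^ν = ∫ P^x ν(dx)`, under which the process has the initial law `ν`. -/
def law (X : MarkovProcess E Ω) (ν : Measure E) : Measure Ω := ν.bind X.prob

/-- `μ` is invariant: `μ p_t = μ` for all `t ≥ 0`. -/
def IsInvariant (X : MarkovProcess E Ω) (μ : Measure E) : Prop :=
  ∀ t : ℝ≥0, Kernel.Invariant (X.transition t) μ

/-- Ergodicity: every set `A` with `P_t 1_A = 1_A` `μ`-almost everywhere for all `t ≥ 0` has
measure `0` or `1`. -/
def IsErgodic (X : MarkovProcess E Ω) (μ : Measure E) : Prop :=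
  ∀ A : Set E, MeasurableSet A →
    (∀ t : ℝ≥0, (fun x => X.transition t x A) =ᵐ[μ] A.indicator 1) → μ A = 0 ∨ μ A = 1

/-- `(P_t)` is strongly continuous on `L²(μ)`, i.e. it has an infinitesimal generator there in the
usual sense. -/
def StronglyContinuousL2 (X : MarkovProcess E Ω) (μ : Measure E) : Prop :=
  ∀ f : E → ℝ, MemLp f 2 μ →
    Tendsto (fun t : ℝ≥0 => eLpNorm (fun x => X.semigroup t f x - f x) 2 μ) (𝓝[>] 0) (𝓝 0)

/-- The graph of the infinitesimal generator `L` of `(P_t)` on `L²(μ)`: the function `f` represents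
an element of the domain of `L`, and `L f = g`, i.e. `(P_t f - f) / t → g` in `L²(μ)` as `t ↓ 0`. -/
def IsGenerator (X : MarkovProcess E Ω) (μ : Measure E) (f g : E → ℝ) : Prop :=
  MemLp f 2 μ ∧ MemLp g 2 μ ∧
    Tendsto (fun t : ℝ≥0 => eLpNorm (fun x => (X.semigroup t f x - f x) / t - g x) 2 μ)
      (𝓝[>] 0) (𝓝 0)

/-- The iterated Poincaré inequality with constant `lam`: `‖L f‖ ≥ lam ‖f‖` in `L²(μ)` for all
centred `f` in the domain of the generator `L`. -/
def IteratedPoincare (X : MarkovProcess E Ω) (μ : Measure E) (lam : ℝ) : Prop :=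
  ∀ f g : E → ℝ, X.IsGenerator μ f g → ∫ x, f x ∂μ = 0 →
    ENNReal.ofReal lam * eLpNorm f 2 μ ≤ eLpNorm g 2 μ

/-- The empirical measure `μ_T = (1/T) ∫_0^T δ_{X_t} dt`, i.e. the normalised image of Lebesgue
measure on `[0, T]` under the path. -/
def empiricalMeasure (X : MarkovProcess E Ω) (T : ℝ) (ω : Ω) : Measure E :=
  ENNReal.ofReal T⁻¹ •
    (volume.restrict (Set.Icc (0 : ℝ) T)).map (fun t : ℝ => X.path t.toNNReal ω)

end MarkovProcess

/-- The optimal transport cost `T_p(ν₀, ν₁)`: the infimum of `∫ |x - y|^p π(dx, dy)` over all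
couplings `π` of `ν₀` and `ν₁`, with values in `[0, ∞]`. -/
def transportCost {E : Type*} [MeasurableSpace E] [NormedAddCommGroup E] (p : ℝ)
    (ν₀ ν₁ : Measure E) : ℝ≥0∞ :=
  ⨅ (π : Measure (E × E)) (_ : π.fst = ν₀ ∧ π.snd = ν₁),
    ∫⁻ z, ENNReal.ofReal (‖z.1 - z.2‖ ^ p) ∂π

/-- The exponent `γ₁ = max {1/4, 1 - p/d}`. -/
def gamma₁ (p : ℝ) (d : ℕ) : ℝ := max (1 / 4) (1 - p / d)

end

noncomputable section

/-! The proof combines a variance bound, an interpolation and a multiscale coupling.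

Variance. For bounded centred `g` put `f_u = ∫_0^u P_s g ds`. It lies in the domain of the generator
and `L f_u = P_u g - g`, so the iterated Poincaré inequality and the contraction property give
`‖f_u‖ ≤ (2/λ)‖g‖` uniformly in `u`; no decay of `P_u g` is needed. By stationarity, the second
moment of `∫_0^T g(X_t) dt` is `∫_0^T (⟨g, f_s⟩ + ⟨g, f_{T-s}⟩) ds`, hence at most `(4/λ)‖g‖² T`
(`integral_sq_timeIntegral_le`).

Interpolation. For a set `A` of measure `m`, the mean deviation `E|μ_T(A) - μ(A)|` is at most `2m`
trivially and at most `(4m/(λT))^{1/2}` by the variance bound. Hence it is at most a constant times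
`T^{-a} m^{1-a}` for every `0 ≤ a ≤ 1/2` (`lintegral_empiricalMeasure_deviation_le`).

Coupling. Cut the dyadic shell of radius `2^n` into cubes of side `2^{n-l}`, and match the two
measures greedily from fine cells to coarse ones. The cost is at most a constant times the sum over
levels and cells of `2^{p(n-l)}` times the deviation on the cell, plus a term that vanishes as the
finest level tends to infinity (`transportCost_le_dyadic`). Insert the deviation bound. By Hölder,
the `2^{ld}` cells (up to a constant) of one shell contribute at most `2^{lda} μ(shell)^{1-a}`,
again up to a constant, and `μ(shell)` is of order at most `2^{-qn}` by the moment assumption. The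
sum over `l` converges if `da < p`, the sum over `n` if `p < q(1-a)`.

The exponent `a = (2/3)(1 - max{γ₁, p/q})` satisfies `a ≤ 1/2` and both strict inequalities. So
`T^{-a}` holds as it stands, and the logarithmic factors only need a positive lower bound on `T ≥
2`. -/

/-! ### Multilevel couplings and the transport cost -/

lemma ENNReal.one_sub_div_max_mul {a b : ℝ≥0∞} (ha : a ≠ ∞) (hb : b ≠ ∞) :
    (1 - b / max a b) * a = a - b := by
  rcases le_total b a with h | h
  · rw [max_eq_left h]
    rcases eq_or_ne a 0 with rfl | h0
    · simp
    · rw [ENNReal.sub_mul (fun _ _ => ha), one_mul, ENNReal.div_mul_cancel h0 ha]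
  · rw [max_eq_right h, tsub_eq_zero_of_le h]
    rcases eq_or_ne b 0 with rfl | h0
    · simp_all
    · rw [ENNReal.div_self h0 hb]; simp

/-- Greedy matching of two measures inside the cells `{c = i}`: the coupled part `π` leaves in each
cell only the excess of one measure over the other. -/
lemma exists_partial_coupling {ι : Type*} [Countable ι] [MeasurableSpace ι]
    [MeasurableSingletonClass ι] {E : Type*} [MeasurableSpace E] (α β : Measure E)
    [IsFiniteMeasure α] [IsFiniteMeasure β] {c : E → ι} (hc : Measurable c) :
    ∃ (π : Measure (E × E)) (α' β' : Measure E), π.fst + α' = α ∧ π.snd + β' = β ∧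
      (∀ᵐ z ∂π, c z.1 = c z.2) ∧
      (∀ i, α' (c ⁻¹' {i}) = α (c ⁻¹' {i}) - β (c ⁻¹' {i})) ∧
      (∀ i, β' (c ⁻¹' {i}) = β (c ⁻¹' {i}) - α (c ⁻¹' {i})) := by
  classical
  set a : ι → ℝ≥0∞ := fun i => α (c ⁻¹' {i})
  set b : ι → ℝ≥0∞ := fun i => β (c ⁻¹' {i})
  -- On a cell of masses `a` and `b`, the density `1 / max a b` with respect to `α × β` has total
  -- mass `a b / max a b = min a b`, the most that can be matched there.
  set m : ι → ℝ≥0∞ := fun i => (max (a i) (b i))⁻¹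
  have hm (f : ι → ℝ≥0∞) : Measurable fun x => f (c x) := (measurable_of_countable f).comp hc
  have hD : MeasurableSet {z : E × E | c z.1 = c z.2} :=
    measurableSet_eq_fun (hc.comp measurable_fst) (hc.comp measurable_snd)
  set ρ : E × E → ℝ≥0∞ := {z : E × E | c z.1 = c z.2}.indicator (fun z => m (c z.1))
  have hρ : Measurable ρ := ((hm m).comp measurable_fst).indicator hD
  have hcell (i : ι) : MeasurableSet (c ⁻¹' {i}) := hc (measurableSet_singleton i)
  have hint (γ : Measure E) (x : E) :
      ∫⁻ y, (c ⁻¹' {c x}).indicator (fun _ => m (c x)) y ∂γ = γ (c ⁻¹' {c x}) * m (c x) := by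
    rw [lintegral_indicator_const (hcell _), mul_comm]
  refine ⟨(α.prod β).withDensity ρ, α.withDensity (fun x => 1 - b (c x) * m (c x)),
    β.withDensity (fun y => 1 - a (c y) * m (c y)), ?_, ?_, ?_, ?_, ?_⟩
  · have h1 : ((α.prod β).withDensity ρ).fst = α.withDensity (fun x => b (c x) * m (c x)) := by
      ext s hs
      rw [Measure.fst_apply hs, withDensity_apply _ (measurable_fst hs), withDensity_apply _ hs,
        ← lintegral_indicator (measurable_fst hs), lintegral_prod _
          ((hρ.indicator (measurable_fst hs)).aemeasurable), ← lintegral_indicator hs]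
      refine lintegral_congr fun x => ?_
      by_cases hx : x ∈ s
      · simp only [Set.indicator_of_mem hx]
        rw [← hint β x]
        refine lintegral_congr fun y => ?_
        simp [ρ, Set.indicator_apply, hx, eq_comm]
      · simp [hx]
    rw [h1, ← withDensity_add_left
      (show Measurable fun x => b (c x) * m (c x) from hm fun i => b i * m i)]
    conv_rhs => rw [← withDensity_one (μ := α)]
    congr 1; ext x
    simp only [Pi.add_apply, Pi.one_apply]
    refine add_tsub_cancel_of_le ?_
    rw [← ENNReal.div_eq_inv_mul.trans (mul_comm _ _)]
    exact ENNReal.div_le_of_le_mul (by simp)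
  · have h1 : ((α.prod β).withDensity ρ).snd = β.withDensity (fun x => a (c x) * m (c x)) := by
      ext s hs
      rw [Measure.snd_apply hs, withDensity_apply _ (measurable_snd hs), withDensity_apply _ hs,
        ← lintegral_indicator (measurable_snd hs), lintegral_prod_symm _
          ((hρ.indicator (measurable_snd hs)).aemeasurable), ← lintegral_indicator hs]
      refine lintegral_congr fun x => ?_
      by_cases hx : x ∈ s
      · simp only [Set.indicator_of_mem hx]
        rw [← hint α x]
        refine lintegral_congr fun y => ?_
        by_cases h : c y = c x <;> simp [ρ, hx, h]
      · simp [hx]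
    rw [h1, ← withDensity_add_left
      (show Measurable fun x => a (c x) * m (c x) from hm fun i => a i * m i)]
    conv_rhs => rw [← withDensity_one (μ := β)]
    congr 1; ext x
    simp only [Pi.add_apply, Pi.one_apply]
    refine add_tsub_cancel_of_le ?_
    rw [← ENNReal.div_eq_inv_mul.trans (mul_comm _ _)]
    exact ENNReal.div_le_of_le_mul (by simp)
  · rw [ae_withDensity_iff hρ]
    refine ae_of_all _ fun z hz => ?_
    by_contra h
    exact hz (Set.indicator_of_notMem (by simpa using h) _)
  · intro i
    rw [withDensity_apply _ (hcell i), setLIntegral_congr_fun (g := fun _ => 1 - b i * m i)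
      (hcell i) (fun x hx => by simp only [Set.mem_preimage, Set.mem_singleton_iff] at hx; simp [hx]),
      setLIntegral_const]
    exact ENNReal.one_sub_div_max_mul (measure_ne_top _ _) (measure_ne_top _ _)
  · intro i
    rw [withDensity_apply _ (hcell i), setLIntegral_congr_fun (g := fun _ => 1 - a i * m i)
      (hcell i) (fun x hx => by simp only [Set.mem_preimage, Set.mem_singleton_iff] at hx; simp [hx]),
      setLIntegral_const]
    simp only [m, max_comm (a i)]
    exact ENNReal.one_sub_div_max_mul (measure_ne_top _ _) (measure_ne_top _ _)

lemma lintegral_comp_eq_tsum {ι : Type*} [Countable ι] [MeasurableSpace ι]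
    [MeasurableSingletonClass ι] {E : Type*} [MeasurableSpace E] (α : Measure E)
    {c : E → ι} (hc : Measurable c) (f : ι → ℝ≥0∞) :
    ∫⁻ x, f (c x) ∂α = ∑' i, f i * α (c ⁻¹' {i}) := by
  rw [← lintegral_map (measurable_of_countable f) hc, lintegral_countable']
  simp_rw [Measure.map_apply hc (measurableSet_singleton _)]

/-- A coupling that never leaves its cell removes the same mass from both measures in each cell, so
it does not change their difference there. -/
lemma measure_fst_preimage_eq_snd {ι E : Type*} [MeasurableSpace ι] [MeasurableSingletonClass ι]
    [MeasurableSpace E] {π : Measure (E × E)} {c : E → ι} (hc : Measurable c)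
    (h : ∀ᵐ z ∂π, c z.1 = c z.2) (i : ι) : π.fst (c ⁻¹' {i}) = π.snd (c ⁻¹' {i}) := by
  have hcell : MeasurableSet (c ⁻¹' {i}) := hc (measurableSet_singleton i)
  rw [Measure.fst_apply hcell, Measure.snd_apply hcell]
  refine measure_congr ?_
  filter_upwards [h] with z hz
  refine propext ?_
  change c z.1 = i ↔ c z.2 = i
  rw [hz]

/-- Greedy matching along a sequence of finer and finer partitions, from level `k + m` down to
level `k`. -/
lemma exists_multilevel_coupling {ι : Type*} [Countable ι] [MeasurableSpace ι]
    [MeasurableSingletonClass ι] {E : Type*} [MeasurableSpace E] (ν₀ ν₁ : Measure E)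
    [IsFiniteMeasure ν₀] [IsFiniteMeasure ν₁] {c : ℕ → E → ι} (hc : ∀ l, Measurable (c l))
    (href : ∀ l x y, c (l + 1) x = c (l + 1) y → c l x = c l y)
    {κ : E × E → ℝ≥0∞} {w : ℕ → ι → ℝ≥0∞} {R : ℝ≥0∞}
    (hκ : ∀ l x y, c l x = c l y → κ (x, y) ≤ w l (c l x))
    (hw : ∀ l x, w l (c l x) ≤ R * w (l + 1) (c (l + 1) x)) (m : ℕ) : ∀ k : ℕ,
    ∃ (π : Measure (E × E)) (α' β' : Measure E), π.fst + α' = ν₀ ∧ π.snd + β' = ν₁ ∧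
      (∀ᵐ z ∂π, c k z.1 = c k z.2) ∧
      (∀ i, α' (c k ⁻¹' {i}) = ν₀ (c k ⁻¹' {i}) - ν₁ (c k ⁻¹' {i})) ∧
      (∀ i, β' (c k ⁻¹' {i}) = ν₁ (c k ⁻¹' {i}) - ν₀ (c k ⁻¹' {i})) ∧
      ∫⁻ z, κ z ∂π ≤ ∫⁻ x, w (k + m) (c (k + m) x) ∂ν₁ + R * ∑ j ∈ Finset.range m,
        ∑' i, w (k + j + 1) i *
          (ν₀ (c (k + j + 1) ⁻¹' {i}) - ν₁ (c (k + j + 1) ⁻¹' {i})) := by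
  have hmeas (l : ℕ) : Measurable fun x => w l (c l x) := (measurable_of_countable _).comp (hc l)
  induction m with
  | zero =>
    intro k
    obtain ⟨π, α', β', h1, h2, h3, h4, h5⟩ := exists_partial_coupling ν₀ ν₁ (hc k)
    refine ⟨π, α', β', h1, h2, h3, h4, h5, ?_⟩
    simp only [add_zero, Finset.range_zero, Finset.sum_empty, mul_zero]
    calc ∫⁻ z, κ z ∂π ≤ ∫⁻ z, w k (c k z.2) ∂π := by
          refine lintegral_mono_ae ?_
          filter_upwards [h3] with z hz
          exact (hκ k z.1 z.2 hz).trans_eq (by rw [hz])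
      _ = ∫⁻ x, w k (c k x) ∂π.snd := by
          rw [Measure.snd, lintegral_map (hmeas k) measurable_snd]
      _ ≤ _ := lintegral_mono' (h2 ▸ Measure.le_add_right le_rfl) le_rfl
  | succ m ih =>
    intro k
    -- The finer levels are matched first; their residues `α`, `β` are then matched in the cells of
    -- level `k`. The mass moved at level `k` is thus at most the excess left at level `k + 1`,
    -- which is why weights of level `k` are compared with those of level `k + 1` through `R`.
    obtain ⟨π, α, β, h1, h2, h3, h4, h5, h6⟩ := ih (k + 1)
    have : IsFiniteMeasure α := isFiniteMeasure_of_le ν₀ (h1 ▸ Measure.le_add_left le_rfl)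
    have : IsFiniteMeasure β := isFiniteMeasure_of_le ν₁ (h2 ▸ Measure.le_add_left le_rfl)
    have hπ : IsFiniteMeasure π.fst := isFiniteMeasure_of_le ν₀ (h1 ▸ Measure.le_add_right le_rfl)
    obtain ⟨π', α', β', g1, g2, g3, g4, g5⟩ := exists_partial_coupling α β (hc k)
    have h3' : ∀ᵐ z ∂π, c k z.1 = c k z.2 := h3.mono fun z hz => href k _ _ hz
    have heq (i : ι) := measure_fst_preimage_eq_snd (hc k) h3' i
    refine ⟨π + π', α', β', ?_, ?_, ?_, ?_, ?_, ?_⟩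
    · rw [Measure.fst_add, add_assoc, g1, h1]
    · rw [Measure.snd_add, add_assoc, g2, h2]
    · exact ae_add_measure_iff.2 ⟨h3', g3⟩
    · intro i
      rw [g4, ← h1, ← h2, Measure.add_apply, Measure.add_apply, ← heq]
      exact (ENNReal.add_sub_add_eq_sub_left (measure_ne_top _ _)).symm
    · intro i
      rw [g5, ← h1, ← h2, Measure.add_apply, Measure.add_apply, ← heq]
      exact (ENNReal.add_sub_add_eq_sub_left (measure_ne_top _ _)).symm
    · have hstep : ∫⁻ z, κ z ∂π' ≤ R * ∑' i, w (k + 1) i *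
          (ν₀ (c (k + 1) ⁻¹' {i}) - ν₁ (c (k + 1) ⁻¹' {i})) := by
        calc ∫⁻ z, κ z ∂π' ≤ ∫⁻ z, w k (c k z.1) ∂π' := by
              refine lintegral_mono_ae ?_
              filter_upwards [g3] with z hz
              exact hκ k z.1 z.2 hz
          _ = ∫⁻ x, w k (c k x) ∂π'.fst := by
              rw [Measure.fst, lintegral_map (hmeas k) measurable_fst]
          _ ≤ ∫⁻ x, R * w (k + 1) (c (k + 1) x) ∂α :=
              lintegral_mono' (g1 ▸ Measure.le_add_right le_rfl) (hw k)
          _ = _ := by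
              rw [lintegral_const_mul _ (hmeas (k + 1)), lintegral_comp_eq_tsum α (hc (k + 1))]
              simp_rw [h4]
      rw [lintegral_add_measure, Finset.sum_range_succ', mul_add, ← add_assoc]
      refine add_le_add (h6.trans_eq ?_) (hstep.trans_eq (by simp))
      simp only [add_assoc, add_comm 1]

/-- After level `0` the two residues have equal total mass. They can be coupled with no restriction
on cells, at a cost that `h0` splits into one level-`0` weight for each endpoint. -/
lemma transportCost_le_multilevel {ι : Type*} [Countable ι] [MeasurableSpace ι]
    [MeasurableSingletonClass ι] {E : Type*} [MeasurableSpace E] [NormedAddCommGroup E]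
    (ν₀ ν₁ : Measure E) [IsProbabilityMeasure ν₀] [IsProbabilityMeasure ν₁] (p : ℝ)
    {c : ℕ → E → ι} (hc : ∀ l, Measurable (c l))
    (href : ∀ l x y, c (l + 1) x = c (l + 1) y → c l x = c l y)
    {w : ℕ → ι → ℝ≥0∞} {R : ℝ≥0∞} (hR : 1 ≤ R)
    (hκ : ∀ l x y, c l x = c l y → ENNReal.ofReal (‖x - y‖ ^ p) ≤ w l (c l x))
    (hw : ∀ l x, w l (c l x) ≤ R * w (l + 1) (c (l + 1) x))
    (h0 : ∀ x y, ENNReal.ofReal (‖x - y‖ ^ p) ≤ w 0 (c 0 x) + w 0 (c 0 y)) (L : ℕ) :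
    transportCost p ν₀ ν₁ ≤ ∫⁻ x, w L (c L x) ∂ν₁ + R * ∑ l ∈ Finset.range (L + 1),
      ∑' i, w l i * ((ν₀ (c l ⁻¹' {i}) - ν₁ (c l ⁻¹' {i})) +
        (ν₁ (c l ⁻¹' {i}) - ν₀ (c l ⁻¹' {i}))) := by
  obtain ⟨π, α, β, h1, h2, h3, h4, h5, h6⟩ := exists_multilevel_coupling ν₀ ν₁
    (κ := fun z => ENNReal.ofReal (‖z.1 - z.2‖ ^ p)) hc href hκ hw L 0
  have : IsFiniteMeasure α := isFiniteMeasure_of_le ν₀ (h1 ▸ Measure.le_add_left le_rfl)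
  have : IsFiniteMeasure β := isFiniteMeasure_of_le ν₁ (h2 ▸ Measure.le_add_left le_rfl)
  have hπ : IsFiniteMeasure π.fst := isFiniteMeasure_of_le ν₀ (h1 ▸ Measure.le_add_right le_rfl)
  have hαβ : α Set.univ = β Set.univ := by
    have e0 := congrArg (· Set.univ) h1
    have e1 := congrArg (· Set.univ) h2
    simp only [Measure.add_apply, measure_univ, Measure.fst_univ, Measure.snd_univ] at e0 e1
    have hfin : π Set.univ ≠ ∞ := by rw [← Measure.fst_univ]; exact measure_ne_top _ _
    exact (ENNReal.add_right_inj hfin).1 (e0.trans e1.symm)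
  -- For the partition into a single cell, equality of the total masses leaves no residue.
  obtain ⟨π', α', β', g1, g2, -, g4, g5⟩ :=
    exists_partial_coupling α β (measurable_const (a := ()))
  have hα' : α' = 0 := by
    have := g4 ()
    simpa [hαβ] using this
  have hβ' : β' = 0 := by
    have := g5 ()
    simpa [hαβ] using this
  rw [hα', add_zero] at g1
  rw [hβ', add_zero] at g2
  have hmeas : Measurable fun x => w 0 (c 0 x) := (measurable_of_countable _).comp (hc 0)
  have hlast : ∫⁻ z, ENNReal.ofReal (‖z.1 - z.2‖ ^ p) ∂π' ≤
      R * ∑' i, w 0 i * ((ν₀ (c 0 ⁻¹' {i}) - ν₁ (c 0 ⁻¹' {i})) +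
        (ν₁ (c 0 ⁻¹' {i}) - ν₀ (c 0 ⁻¹' {i}))) := by
    calc _ ≤ ∫⁻ z, (w 0 (c 0 z.1) + w 0 (c 0 z.2)) ∂π' := lintegral_mono fun z => h0 z.1 z.2
      _ = ∫⁻ x, w 0 (c 0 x) ∂α + ∫⁻ x, w 0 (c 0 x) ∂β := by
          rw [lintegral_add_left (show Measurable fun z : E × E => w 0 (c 0 z.1) from
            hmeas.comp measurable_fst), ← g1, ← g2, Measure.fst, Measure.snd,
            lintegral_map hmeas measurable_fst, lintegral_map hmeas measurable_snd]
      _ = ∑' i, w 0 i * ((ν₀ (c 0 ⁻¹' {i}) - ν₁ (c 0 ⁻¹' {i})) +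
        (ν₁ (c 0 ⁻¹' {i}) - ν₀ (c 0 ⁻¹' {i}))) := by
          rw [lintegral_comp_eq_tsum α (hc 0), lintegral_comp_eq_tsum β (hc 0), ← ENNReal.tsum_add]
          simp_rw [h4, h5, mul_add]
      _ ≤ _ := le_mul_of_one_le_left zero_le hR
  have hπ' : (π + π').fst = ν₀ ∧ (π + π').snd = ν₁ :=
    ⟨by rw [Measure.fst_add, g1, h1], by rw [Measure.snd_add, g2, h2]⟩
  refine (iInf₂_le (π + π') hπ').trans ?_
  rw [lintegral_add_measure, Finset.sum_range_succ', mul_add, ← add_assoc]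
  refine add_le_add (h6.trans ?_) hlast
  simp only [zero_add]
  gcongr
  exact le_self_add

/-! ### Second moments and time averages -/

lemma eLpNorm_two_sq {α : Type*} [MeasurableSpace α] (μ : Measure α) (f : α → ℝ) :
    eLpNorm f 2 μ ^ 2 = ∫⁻ x, ‖f x‖ₑ ^ 2 ∂μ := by
  have := eLpNorm_nnreal_pow_eq_lintegral (μ := μ) (f := f) (p := 2) (by norm_num)
  simpa using this

lemma enorm_integral_sq_le {α : Type*} [MeasurableSpace α] (ν : Measure α)
    [IsProbabilityMeasure ν] {f : α → ℝ} (hf : AEStronglyMeasurable f ν) :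
    ‖∫ x, f x ∂ν‖ₑ ^ 2 ≤ ∫⁻ x, ‖f x‖ₑ ^ 2 ∂ν := by
  rw [← eLpNorm_two_sq]
  gcongr
  refine (enorm_integral_le_lintegral_enorm f).trans ?_
  rw [← eLpNorm_one_eq_lintegral_enorm]
  exact eLpNorm_le_eLpNorm_of_exponent_le (by norm_num) hf

/-- Jensen for the uniform law on `(0, t]`, followed by Tonelli. -/
lemma eLpNorm_time_average_le {α : Type*} [MeasurableSpace α] (μ : Measure α) [SFinite μ]
    {F : ℝ → α → ℝ} (hF : Measurable (Function.uncurry F)) {t : ℝ} (ht : 0 < t) {ε : ℝ≥0∞}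
    (h : ∀ s ∈ Set.Ioc 0 t, eLpNorm (F s) 2 μ ≤ ε) :
    eLpNorm (fun x => (∫ s in (0 : ℝ)..t, F s x) / t) 2 μ ≤ ε := by
  set U : Measure ℝ := ENNReal.ofReal t⁻¹ • volume.restrict (Set.Ioc 0 t) with hU
  have hUp : IsProbabilityMeasure U := ⟨by
    simp [hU, ← ENNReal.ofReal_mul (inv_nonneg.2 ht.le), inv_mul_cancel₀ ht.ne']⟩
  have hint (x : α) : (∫ s in (0 : ℝ)..t, F s x) / t = ∫ s, F s x ∂U := by
    rw [intervalIntegral.integral_of_le ht.le, hU, integral_smul_measure,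
      ENNReal.toReal_ofReal (inv_nonneg.2 ht.le), smul_eq_mul, div_eq_inv_mul]
  rw [← ENNReal.pow_le_pow_left_iff (two_ne_zero), eLpNorm_two_sq]
  calc ∫⁻ x, ‖(∫ s in (0 : ℝ)..t, F s x) / t‖ₑ ^ 2 ∂μ
      ≤ ∫⁻ x, ∫⁻ s, ‖F s x‖ₑ ^ 2 ∂U ∂μ := by
        refine lintegral_mono fun x => ?_
        simp only [hint]
        exact enorm_integral_sq_le U (hF.comp measurable_prodMk_right).aestronglyMeasurable
    _ = ∫⁻ s, ∫⁻ x, ‖F s x‖ₑ ^ 2 ∂μ ∂U := by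
        rw [lintegral_lintegral_swap]
        exact ((hF.comp measurable_swap).enorm.pow_const 2).aemeasurable
    _ ≤ ∫⁻ _, ε ^ 2 ∂U := by
        refine lintegral_mono_ae ?_
        have : ∀ᵐ s ∂U, s ∈ Set.Ioc 0 t :=
          Measure.ae_smul_measure (ae_restrict_mem measurableSet_Ioc) _
        filter_upwards [this] with s hs
        rw [← eLpNorm_two_sq]
        gcongr
        exact h s hs
    _ = ε ^ 2 := by simp

lemma integrable_of_abs_le {α : Type*} [MeasurableSpace α] {ν : Measure α} [IsFiniteMeasure ν]
    {g : α → ℝ} (hg : Measurable g) {M : ℝ} (hM : ∀ x, |g x| ≤ M) : Integrable g ν :=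
  Integrable.of_bound hg.aestronglyMeasurable M (ae_of_all _ hM)

/-! ### The semigroup on bounded functions -/

namespace MarkovProcess

variable {E : Type*} [MeasurableSpace E] {Ω : Type*} [MeasurableSpace Ω]

instance (X : MarkovProcess E Ω) : IsMarkovKernel X.prob := X.isMarkovKernel

lemma measurable_path_apply (X : MarkovProcess E Ω) (t : ℝ≥0) : Measurable (X.path t) :=
  X.measurable_path.comp measurable_prodMk_left

instance (X : MarkovProcess E Ω) (t : ℝ≥0) : IsMarkovKernel (X.transition t) :=
  Kernel.IsMarkovKernel.map _ (X.measurable_path_apply t)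

lemma transition_apply (X : MarkovProcess E Ω) (t : ℝ≥0) (x : E) :
    X.transition t x = (X.prob x).map (X.path t) :=
  Kernel.map_apply _ (X.measurable_path_apply t) x

lemma semigroup_eq_integral (X : MarkovProcess E Ω) (t : ℝ≥0) {g : E → ℝ} (hg : Measurable g)
    (x : E) : X.semigroup t g x = ∫ y, g y ∂(X.transition t x) := by
  rw [transition_apply, integral_map (X.measurable_path_apply t).aemeasurable
    hg.aestronglyMeasurable, semigroup]

/-- Chapman–Kolmogorov: the Markov property with the sure event in the past. -/
lemma transition_add (X : MarkovProcess E Ω) (s t : ℝ≥0) :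
    X.transition (s + t) = X.transition t ∘ₖ X.transition s := by
  ext x A hA
  rw [Kernel.comp_apply' _ _ _ hA, transition_apply, transition_apply,
    lintegral_map (Kernel.measurable_coe _ hA) (X.measurable_path_apply s),
    Measure.map_apply (X.measurable_path_apply _) hA]
  have := X.markov x s t A hA Set.univ MeasurableSet.univ
  rw [Set.univ_inter, Measure.restrict_univ] at this
  rw [this]
  refine lintegral_congr fun ω => ?_
  rw [transition_apply, Measure.map_apply (X.measurable_path_apply _) hA]

lemma measurable_semigroup (X : MarkovProcess E Ω) {g : E → ℝ} (hg : Measurable g) :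
    Measurable fun z : ℝ≥0 × E => X.semigroup z.1 g z.2 := by
  have h : StronglyMeasurable fun z : (ℝ≥0 × E) × Ω => g (X.path z.1.1 z.2) :=
    (hg.comp (X.measurable_path.comp
      ((measurable_fst.comp measurable_fst).prodMk measurable_snd))).stronglyMeasurable
  exact (h.integral_kernel_prod_right'
    (κ := X.prob.comap Prod.snd measurable_snd)).measurable

lemma measurable_semigroup_apply (X : MarkovProcess E Ω) {g : E → ℝ} (hg : Measurable g)
    (t : ℝ≥0) : Measurable (X.semigroup t g) :=
  (X.measurable_semigroup hg).comp measurable_prodMk_left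

lemma measurable_semigroup_real (X : MarkovProcess E Ω) {g : E → ℝ} (hg : Measurable g) :
    Measurable fun z : ℝ × E => X.semigroup z.1.toNNReal g z.2 :=
  (X.measurable_semigroup hg).comp (by fun_prop : Measurable fun z : ℝ × E => (z.1.toNNReal, z.2))

lemma abs_semigroup_le (X : MarkovProcess E Ω) {g : E → ℝ} {M : ℝ} (hM : ∀ x, |g x| ≤ M)
    (t : ℝ≥0) (x : E) : |X.semigroup t g x| ≤ M := by
  have := norm_integral_le_of_norm_le_const (μ := X.prob x) (f := fun ω => g (X.path t ω))
    (C := M) (ae_of_all _ fun ω => hM _)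
  simpa [semigroup] using this

lemma semigroup_add (X : MarkovProcess E Ω) {g : E → ℝ} (hg : Measurable g) {M : ℝ}
    (hM : ∀ x, |g x| ≤ M) (s t : ℝ≥0) (x : E) :
    X.semigroup (s + t) g x = X.semigroup s (X.semigroup t g) x := by
  rw [X.semigroup_eq_integral _ hg, transition_add,
    Kernel.integral_comp (integrable_of_abs_le hg hM),
    X.semigroup_eq_integral _ (X.measurable_semigroup_apply hg t)]
  simp_rw [X.semigroup_eq_integral _ hg]

lemma integral_semigroup (X : MarkovProcess E Ω) {μ : Measure E} [IsProbabilityMeasure μ]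
    (hinv : X.IsInvariant μ) {g : E → ℝ} (hg : Measurable g) {M : ℝ} (hM : ∀ x, |g x| ≤ M)
    (t : ℝ≥0) : ∫ x, X.semigroup t g x ∂μ = ∫ x, g x ∂μ := by
  simp_rw [X.semigroup_eq_integral _ hg]
  conv_rhs => rw [← (hinv t).def]
  have h := Kernel.integral_comp (κ := Kernel.const Unit μ) (η := X.transition t) (a := ())
    (integrable_of_abs_le hg hM)
  rw [Kernel.comp_apply, Kernel.const_apply] at h
  exact h.symm

/-- Jensen for the transition kernel, then invariance of `μ`. -/
lemma eLpNorm_semigroup_le (X : MarkovProcess E Ω) {μ : Measure E} (hinv : X.IsInvariant μ)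
    {g : E → ℝ} (hg : Measurable g) (t : ℝ≥0) :
    eLpNorm (X.semigroup t g) 2 μ ≤ eLpNorm g 2 μ := by
  rw [← ENNReal.pow_le_pow_left_iff (two_ne_zero), eLpNorm_two_sq, eLpNorm_two_sq]
  have hm : Measurable fun x => ‖g x‖ₑ ^ 2 := hg.enorm.pow_const 2
  conv_rhs => rw [← (hinv t).def]
  rw [Measure.lintegral_bind (Kernel.aemeasurable _) hm.aemeasurable]
  refine lintegral_mono fun x => ?_
  rw [X.semigroup_eq_integral _ hg]
  exact enorm_integral_sq_le _ hg.aestronglyMeasurable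

/-! ### The integrated semigroup and the generator -/

/-- The integrated semigroup `∫_0^u P_s g ds`. -/
def integratedSemigroup (X : MarkovProcess E Ω) (u : ℝ) (g : E → ℝ) (x : E) : ℝ :=
  ∫ s in (0 : ℝ)..u, X.semigroup s.toNNReal g x

lemma intervalIntegrable_semigroup (X : MarkovProcess E Ω) {g : E → ℝ} (hg : Measurable g) {M : ℝ}
    (hM : ∀ x, |g x| ≤ M) (x : E) (a b : ℝ) :
    IntervalIntegrable (fun s : ℝ => X.semigroup s.toNNReal g x) volume a b := by
  rw [intervalIntegrable_iff]
  have : IsFiniteMeasure ((volume : Measure ℝ).restrict (Set.uIoc a b)) :=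
    ⟨by simp [Set.uIoc]⟩
  exact integrable_of_abs_le ((X.measurable_semigroup_real hg).comp measurable_prodMk_right)
    fun s => X.abs_semigroup_le hM _ _

lemma measurable_integratedSemigroup (X : MarkovProcess E Ω) {g : E → ℝ} (hg : Measurable g)
    (u : ℝ) : Measurable (X.integratedSemigroup u g) := by
  have h : StronglyMeasurable fun z : E × ℝ => X.semigroup z.2.toNNReal g z.1 :=
    ((X.measurable_semigroup_real hg).comp measurable_swap).stronglyMeasurable
  exact (h.integral_prod_right.sub h.integral_prod_right).measurable

lemma abs_integratedSemigroup_le (X : MarkovProcess E Ω) {g : E → ℝ} {M : ℝ}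
    (hM : ∀ x, |g x| ≤ M) (u : ℝ) (x : E) : |X.integratedSemigroup u g x| ≤ M * |u| := by
  have := intervalIntegral.norm_integral_le_of_norm_le_const (a := 0) (b := u) (C := M)
    (f := fun s : ℝ => X.semigroup s.toNNReal g x) fun s _ => X.abs_semigroup_le hM _ _
  simpa [integratedSemigroup] using this

lemma integral_integratedSemigroup_mul (X : MarkovProcess E Ω) {ν : Measure E}
    [IsProbabilityMeasure ν] {g : E → ℝ} (hg : Measurable g) {M : ℝ} (hM : ∀ x, |g x| ≤ M)
    {f : E → ℝ} (hf : Measurable f) {N : ℝ} (hN : ∀ x, |f x| ≤ N) (u : ℝ) :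
    ∫ x, f x * X.integratedSemigroup u g x ∂ν =
      ∫ s in (0 : ℝ)..u, ∫ x, f x * X.semigroup s.toNNReal g x ∂ν := by
  simp_rw [integratedSemigroup, ← intervalIntegral.integral_const_mul]
  refine (intervalIntegral_integral_swap ?_).symm
  have : IsFiniteMeasure ((volume : Measure ℝ).restrict (Set.uIoc 0 u)) :=
    ⟨by simp [Set.uIoc]⟩
  refine integrable_of_abs_le (M := N * M)
    ((hf.comp measurable_snd).mul (X.measurable_semigroup_real hg)) fun z => ?_
  change |f z.2 * X.semigroup z.1.toNNReal g z.2| ≤ _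
  rw [abs_mul]
  exact mul_le_mul (hN _) (X.abs_semigroup_le hM _ _) (abs_nonneg _)
    ((abs_nonneg _).trans (hN z.2))

/-- By the semigroup law both sides are differences of integrals of `s ↦ P_s g x`: `∫_t^{t+u} -
∫_0^u` on the left and `∫_u^{t+u} - ∫_0^t` on the right. Divided by `t`, the right side is a
difference of averages over `[0, t]`, whose limit as `t ↓ 0` is known. -/
lemma semigroup_integratedSemigroup_sub (X : MarkovProcess E Ω) {g : E → ℝ} (hg : Measurable g)
    {M : ℝ} (hM : ∀ x, |g x| ≤ M) (u t : ℝ≥0) (x : E) :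
    X.semigroup t (X.integratedSemigroup u g) x - X.integratedSemigroup u g x =
      X.integratedSemigroup t (X.semigroup u g) x - X.integratedSemigroup t g x := by
  have hI := X.intervalIntegrable_semigroup hg hM x
  have h1 : X.semigroup t (X.integratedSemigroup u g) x =
      ∫ s in (t : ℝ)..(t + u), X.semigroup s.toNNReal g x := by
    have := X.integral_integratedSemigroup_mul (ν := X.transition t x) hg hM
      (measurable_const (a := (1 : ℝ))) (N := 1) (by simp) u
    simp only [one_mul] at this
    rw [X.semigroup_eq_integral _ (X.measurable_integratedSemigroup hg u), this]
    have h2 : ∫ s in (t : ℝ)..(t + u), X.semigroup s.toNNReal g x =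
        ∫ s in (0 : ℝ)..u, X.semigroup (t + s : ℝ).toNNReal g x := by
      rw [intervalIntegral.integral_comp_add_left (fun s => X.semigroup s.toNNReal g x), add_zero]
    rw [h2]
    refine intervalIntegral.integral_congr fun s hs => ?_
    rw [Set.uIcc_of_le u.coe_nonneg] at hs
    rw [Real.toNNReal_add t.coe_nonneg hs.1, Real.toNNReal_coe, X.semigroup_add hg hM,
      X.semigroup_eq_integral t (X.measurable_semigroup_apply hg _)]
  have h3 : X.integratedSemigroup t (X.semigroup u g) x =
      ∫ s in (u : ℝ)..(t + u), X.semigroup s.toNNReal g x := by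
    have h2 : ∫ s in (u : ℝ)..(t + u), X.semigroup s.toNNReal g x =
        ∫ s in (0 : ℝ)..t, X.semigroup (s + u : ℝ).toNNReal g x := by
      rw [intervalIntegral.integral_comp_add_right (fun s => X.semigroup s.toNNReal g x), zero_add]
    rw [h2]
    refine intervalIntegral.integral_congr fun s hs => ?_
    rw [Set.uIcc_of_le t.coe_nonneg] at hs
    rw [Real.toNNReal_add hs.1 u.coe_nonneg, Real.toNNReal_coe, X.semigroup_add hg hM]
  rw [h1, h3, integratedSemigroup, integratedSemigroup]
  have e1 := intervalIntegral.integral_add_adjacent_intervals (hI 0 t) (hI t (t + u))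
  have e2 := intervalIntegral.integral_add_adjacent_intervals (hI 0 u) (hI u (t + u))
  linarith

lemma tendsto_integratedSemigroup_div (X : MarkovProcess E Ω) {μ : Measure E}
    [IsProbabilityMeasure μ] (hcont : X.StronglyContinuousL2 μ) {g : E → ℝ} (hg : Measurable g)
    {M : ℝ} (hM : ∀ x, |g x| ≤ M) :
    Tendsto (fun t : ℝ≥0 => eLpNorm (fun x => X.integratedSemigroup t g x / t - g x) 2 μ)
      (𝓝[>] 0) (𝓝 0) := by
  have h0 := hcont g (MemLp.of_bound hg.aestronglyMeasurable M (ae_of_all _ hM))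
  rw [ENNReal.tendsto_nhds_zero] at h0 ⊢
  intro ε hε
  have := h0 ε hε
  rw [eventually_nhdsWithin_iff, Metric.eventually_nhds_iff] at this
  obtain ⟨δ, hδ, h⟩ := this
  have hδ' : Set.Ioo (0 : ℝ≥0) δ.toNNReal ∈ 𝓝[>] (0 : ℝ≥0) :=
    Ioo_mem_nhdsGT (by simpa using hδ)
  filter_upwards [hδ'] with t ht
  have htpos : (0 : ℝ) < t := ht.1
  have key (x : E) : X.integratedSemigroup t g x / t - g x =
      (∫ s in (0 : ℝ)..t, (X.semigroup s.toNNReal g x - g x)) / t := by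
    rw [intervalIntegral.integral_sub (X.intervalIntegrable_semigroup hg hM x _ _) (by simp),
      intervalIntegral.integral_const, integratedSemigroup]
    field_simp
    simp [mul_comm]
  simp_rw [key]
  refine eLpNorm_time_average_le μ (F := fun s x => X.semigroup s.toNNReal g x - g x)
    ((X.measurable_semigroup_real hg).sub (hg.comp measurable_snd)) htpos fun s hs => ?_
  refine h ?_ (by simpa using hs.1)
  rw [NNReal.dist_eq, Real.coe_toNNReal _ hs.1.le]
  simp only [NNReal.coe_zero, sub_zero, abs_of_pos hs.1]
  have := ht.2
  rw [Real.lt_toNNReal_iff_coe_lt] at this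
  exact hs.2.trans_lt this

/-- The difference quotient at `t` is the average over `[0, t]` of `P_s (P_u g) - P_s g`, and strong
continuity applies to `P_u g` and `g` separately. -/
lemma isGenerator_integratedSemigroup (X : MarkovProcess E Ω) {μ : Measure E}
    [IsProbabilityMeasure μ] (hcont : X.StronglyContinuousL2 μ) {g : E → ℝ} (hg : Measurable g)
    {M : ℝ} (hM : ∀ x, |g x| ≤ M) (u : ℝ≥0) :
    X.IsGenerator μ (X.integratedSemigroup u g) (fun x => X.semigroup u g x - g x) := by
  have hPg := X.measurable_semigroup_apply hg u
  have hPM := X.abs_semigroup_le hM u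
  refine ⟨MemLp.of_bound (X.measurable_integratedSemigroup hg u).aestronglyMeasurable _
    (ae_of_all _ (X.abs_integratedSemigroup_le hM u)),
    MemLp.of_bound (hPg.sub hg).aestronglyMeasurable (M + M)
    (ae_of_all _ fun x => (abs_sub _ _).trans (add_le_add (hPM x) (hM x))), ?_⟩
  have h1 := X.tendsto_integratedSemigroup_div hcont hPg hPM
  have h2 := X.tendsto_integratedSemigroup_div hcont hg hM
  have h12 := h1.add h2
  rw [add_zero] at h12
  refine tendsto_of_tendsto_of_tendsto_of_le_of_le tendsto_const_nhds h12 (fun _ => zero_le)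
    fun t => ?_
  have heq : (fun x => (X.semigroup t (X.integratedSemigroup u g) x -
      X.integratedSemigroup u g x) / t - (X.semigroup u g x - g x)) =
      (fun x => X.integratedSemigroup t (X.semigroup u g) x / t - X.semigroup u g x) -
        fun x => X.integratedSemigroup t g x / t - g x := by
    ext x
    rw [X.semigroup_integratedSemigroup_sub hg hM]
    simp only [Pi.sub_apply]
    ring
  simp only [heq]
  exact eLpNorm_sub_le
    (((X.measurable_integratedSemigroup hPg t).div_const _).sub hPg).aestronglyMeasurable
    (((X.measurable_integratedSemigroup hg t).div_const _).sub hg).aestronglyMeasurable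
    (by norm_num)

/-- The iterated Poincaré inequality applied to the integrated semigroup, whose image under the
generator is `P_u g - g`, of norm at most `2‖g‖`. The bound does not grow with `u`, which makes the
variance linear in time. -/
lemma eLpNorm_integratedSemigroup_le (X : MarkovProcess E Ω) {μ : Measure E}
    [IsProbabilityMeasure μ] (hinv : X.IsInvariant μ) (hcont : X.StronglyContinuousL2 μ)
    {lam : ℝ} (hH2 : X.IteratedPoincare μ lam) {g : E → ℝ} (hg : Measurable g)
    {M : ℝ} (hM : ∀ x, |g x| ≤ M) (hg0 : ∫ x, g x ∂μ = 0) (u : ℝ≥0) :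
    ENNReal.ofReal lam * eLpNorm (X.integratedSemigroup u g) 2 μ ≤ 2 * eLpNorm g 2 μ := by
  refine (hH2 _ _ (X.isGenerator_integratedSemigroup hcont hg hM u) ?_).trans ?_
  · have := X.integral_integratedSemigroup_mul (ν := μ) hg hM
      (measurable_const (a := (1 : ℝ))) (N := 1) (by simp) u
    simp only [one_mul] at this
    rw [this]
    simp [X.integral_semigroup hinv hg hM, hg0]
  · refine (eLpNorm_sub_le (X.measurable_semigroup_apply hg u).aestronglyMeasurable
      hg.aestronglyMeasurable (by norm_num)).trans ?_
    rw [two_mul]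
    gcongr
    exact X.eLpNorm_semigroup_le hinv hg u

end MarkovProcess

/-! ### Correlations and the variance of time integrals -/

lemma ENNReal.sub_add_sub_eq_ofReal_abs {a b : ℝ≥0∞} (ha : a ≠ ∞) (hb : b ≠ ∞) :
    (a - b) + (b - a) = ENNReal.ofReal |a.toReal - b.toReal| := by
  rcases le_total a b with h | h
  · have := ENNReal.toReal_mono hb h
    rw [tsub_eq_zero_of_le h, zero_add, abs_of_nonpos (by linarith), neg_sub,
      ENNReal.ofReal_sub _ ENNReal.toReal_nonneg, ENNReal.ofReal_toReal ha, ENNReal.ofReal_toReal hb]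
  · have := ENNReal.toReal_mono ha h
    rw [tsub_eq_zero_of_le h, add_zero, abs_of_nonneg (by linarith),
      ENNReal.ofReal_sub _ ENNReal.toReal_nonneg, ENNReal.ofReal_toReal ha, ENNReal.ofReal_toReal hb]

lemma eLpNorm_two_sq_eq_ofReal {α : Type*} [MeasurableSpace α] {ν : Measure α} [IsFiniteMeasure ν]
    {f : α → ℝ} (hf : Measurable f) {M : ℝ} (hM : ∀ x, |f x| ≤ M) :
    eLpNorm f 2 ν ^ 2 = ENNReal.ofReal (∫ x, f x ^ 2 ∂ν) := by
  have hb (x : α) : |f x ^ 2| ≤ M ^ 2 := by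
    rw [abs_pow]; exact pow_le_pow_left₀ (abs_nonneg _) (hM x) 2
  rw [eLpNorm_two_sq, ofReal_integral_eq_lintegral_ofReal
    (integrable_of_abs_le (hf.pow_const 2) hb) (ae_of_all _ fun x => sq_nonneg _)]
  refine lintegral_congr fun x => ?_
  rw [← sq_abs, ENNReal.ofReal_pow (abs_nonneg _), Real.enorm_eq_ofReal_abs]

lemma sq_integral_abs_le {α : Type*} [MeasurableSpace α] {ν : Measure α} [IsProbabilityMeasure ν]
    {f : α → ℝ} (hf : Measurable f) {M : ℝ} (hM : ∀ x, |f x| ≤ M) :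
    (∫ x, |f x| ∂ν) ^ 2 ≤ ∫ x, f x ^ 2 ∂ν := by
  have hb (x : α) : |f x ^ 2| ≤ M ^ 2 := by
    rw [abs_pow]; exact pow_le_pow_left₀ (abs_nonneg _) (hM x) 2
  have i1 : Integrable (fun x => f x ^ 2) ν := integrable_of_abs_le (hf.pow_const 2) hb
  have i2 : Integrable (fun x => |f x|) ν := (integrable_of_abs_le hf hM).abs
  set c := ∫ x, |f x| ∂ν with hc
  have h0 : 0 ≤ ∫ x, (|f x| - c) ^ 2 ∂ν := integral_nonneg fun x => sq_nonneg _
  have h1 : ∫ x, (|f x| - c) ^ 2 ∂ν = ∫ x, f x ^ 2 ∂ν - c ^ 2 := by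
    have : ∀ x, (|f x| - c) ^ 2 = f x ^ 2 - (2 * c) * |f x| + c ^ 2 := fun x => by
      -- The inequality is nonnegativity of the variance of `|f|`.
      rw [← sq_abs (f x)]; ring
    simp_rw [this]
    rw [integral_add (show Integrable (fun x => f x ^ 2 - 2 * c * |f x|) ν from
      i1.sub (i2.const_mul _)) (integrable_const _), integral_sub i1
      (i2.const_mul _), integral_const_mul, ← hc]
    simp; ring
  linarith

namespace MarkovProcess

variable {E : Type*} [MeasurableSpace E] {Ω : Type*} [MeasurableSpace Ω]

lemma integral_mul_integratedSemigroup_le (X : MarkovProcess E Ω) {μ : Measure E}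
    [IsProbabilityMeasure μ] (hinv : X.IsInvariant μ) (hcont : X.StronglyContinuousL2 μ)
    {lam : ℝ} (hlam : 0 < lam) (hH2 : X.IteratedPoincare μ lam) {g : E → ℝ} (hg : Measurable g)
    {M : ℝ} (hM : ∀ x, |g x| ≤ M) (hg0 : ∫ x, g x ∂μ = 0) (u : ℝ≥0) :
    ∫ x, g x * X.integratedSemigroup u g x ∂μ ≤ 2 / lam * ∫ x, g x ^ 2 ∂μ := by
  set f := X.integratedSemigroup u g with hf
  have hfm : Measurable f := X.measurable_integratedSemigroup hg u
  have hfM : ∀ x, |f x| ≤ M * |(u : ℝ)| := X.abs_integratedSemigroup_le hM u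
  have ig : Integrable (fun x => g x ^ 2) μ := integrable_of_abs_le (hg.pow_const 2) (M := M ^ 2)
    fun x => by rw [abs_pow]; exact pow_le_pow_left₀ (abs_nonneg _) (hM x) 2
  have jf : Integrable (fun x => f x ^ 2) μ := integrable_of_abs_le (hfm.pow_const 2)
    (M := (M * |(u : ℝ)|) ^ 2)
    fun x => by rw [abs_pow]; exact pow_le_pow_left₀ (abs_nonneg _) (hfM x) 2
  have igf : Integrable (fun x => g x * f x) μ := integrable_of_abs_le (hg.mul hfm)
    (M := M * (M * |(u : ℝ)|)) fun x => by
      rw [abs_mul]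
      exact mul_le_mul (hM x) (hfM x) (abs_nonneg _) ((abs_nonneg _).trans (hM x))
  have hsq : lam ^ 2 * ∫ x, f x ^ 2 ∂μ ≤ 4 * ∫ x, g x ^ 2 ∂μ := by
    have h := X.eLpNorm_integratedSemigroup_le hinv hcont hH2 hg hM hg0 u
    have h2 := pow_le_pow_left' h 2
    have hg2 : 0 ≤ ∫ x, g x ^ 2 ∂μ := integral_nonneg fun x => sq_nonneg _
    rw [mul_pow, mul_pow, eLpNorm_two_sq_eq_ofReal hfm hfM, eLpNorm_two_sq_eq_ofReal hg hM,
      ← ENNReal.ofReal_pow hlam.le, ← ENNReal.ofReal_mul (by positivity),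
      show (2 : ℝ≥0∞) ^ 2 = ENNReal.ofReal 4 by norm_num,
      ← ENNReal.ofReal_mul (by norm_num)] at h2
    exact (ENNReal.ofReal_le_ofReal_iff (by positivity)).1 h2
  -- Young's inequality, weighted so that `λ²‖f‖² ≤ 4‖g‖²` bounds each of the two terms by `‖g‖²/λ`.
  have hpt : ∀ x, g x * f x ≤ 1 / lam * g x ^ 2 + lam / 4 * f x ^ 2 := fun x => by
    have : 0 ≤ (1 / lam) * (g x - lam / 2 * f x) ^ 2 := by positivity
    have h2 : (1 / lam) * (g x - lam / 2 * f x) ^ 2 =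
      1 / lam * g x ^ 2 + lam / 4 * f x ^ 2 - g x * f x := by field_simp; ring
    linarith
  have h3 := integral_mono igf ((ig.const_mul (1 / lam)).add (jf.const_mul (lam / 4))) hpt
  simp only [Pi.add_apply] at h3
  rw [integral_add (ig.const_mul _) (jf.const_mul _), integral_const_mul, integral_const_mul] at h3
  have h4 : lam / 4 * ∫ x, f x ^ 2 ∂μ ≤ 1 / lam * ∫ x, g x ^ 2 ∂μ := by
    have := mul_le_mul_of_nonneg_left hsq (by positivity : 0 ≤ 1 / (4 * lam))
    calc lam / 4 * ∫ x, f x ^ 2 ∂μ = 1 / (4 * lam) * (lam ^ 2 * ∫ x, f x ^ 2 ∂μ) := by field_simp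
      _ ≤ _ := this
      _ = _ := by field_simp
  calc _ ≤ _ := h3
    _ ≤ 1 / lam * ∫ x, g x ^ 2 ∂μ + 1 / lam * ∫ x, g x ^ 2 ∂μ := by gcongr
    _ = _ := by ring

instance (X : MarkovProcess E Ω) (μ : Measure E) [IsProbabilityMeasure μ] :
    IsProbabilityMeasure (X.law μ) := by
  unfold law; infer_instance

lemma law_map_path (X : MarkovProcess E Ω) {μ : Measure E} (hinv : X.IsInvariant μ) (t : ℝ≥0) :
    (X.law μ).map (X.path t) = μ := by
  rw [law, Measure.map_comp _ _ (X.measurable_path_apply t)]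
  exact (hinv t).def

/-- The two-time law of the stationary process depends only on the lag `v`. It suffices to test
rectangles, where the Markov property applies to the event `X_s ∈ A`. -/
lemma law_map_pair (X : MarkovProcess E Ω) {μ : Measure E} [IsProbabilityMeasure μ]
    (hinv : X.IsInvariant μ) (s v : ℝ≥0) :
    (X.law μ).map (fun ω => (X.path s ω, X.path (s + v) ω)) = μ ⊗ₘ X.transition v := by
  have hm : Measurable fun ω => (X.path s ω, X.path (s + v) ω) :=
    (X.measurable_path_apply s).prodMk (X.measurable_path_apply _)
  have : IsProbabilityMeasure ((X.law μ).map (fun ω => (X.path s ω, X.path (s + v) ω))) :=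
    Measure.isProbabilityMeasure_map hm.aemeasurable
  refine Measure.ext_prod fun {A B} hA hB => ?_
  rw [Measure.map_apply hm (hA.prod hB), Measure.compProd_apply_prod hA hB, law,
    Measure.bind_apply (hm (hA.prod hB)) (Kernel.aemeasurable _)]
  have hF : Measurable (A.indicator fun y => X.transition v y B) :=
    (Kernel.measurable_coe _ hB).indicator hA
  have key (x : E) : X.prob x ((fun ω => (X.path s ω, X.path (s + v) ω)) ⁻¹' A ×ˢ B) =
      ∫⁻ ω, A.indicator (fun y => X.transition v y B) (X.path s ω) ∂(X.prob x) := by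
    have hAs : MeasurableSet (X.path s ⁻¹' A) := X.measurable_path_apply s hA
    have hAs' : MeasurableSet[⨆ r ≤ s, MeasurableSpace.comap (X.path r) inferInstance]
        (X.path s ⁻¹' A) := by
      refine (le_iSup₂_of_le (f := fun r (_ : r ≤ s) =>
        MeasurableSpace.comap (X.path r) inferInstance) s le_rfl le_rfl) _ ⟨A, hA, rfl⟩
    rw [Set.mk_preimage_prod, X.markov x s v B hB _ hAs', ← lintegral_indicator hAs]
    refine lintegral_congr fun ω => ?_
    have hB' : (fun y => X.transition v y B) = fun y => X.prob y (X.path v ⁻¹' B) := by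
      ext y
      rw [transition_apply, Measure.map_apply (X.measurable_path_apply _) hB]
    rw [hB']
    rfl
  simp_rw [key]
  rw [← Measure.lintegral_bind (m := μ) (μ := X.prob) (Kernel.aemeasurable _)
    (f := fun ω => A.indicator (fun y => X.transition v y B) (X.path s ω))
    (hF.comp (X.measurable_path_apply s)).aemeasurable, ← law,
    ← lintegral_map hF (X.measurable_path_apply s), X.law_map_path hinv, lintegral_indicator hA]

lemma integral_law_path (X : MarkovProcess E Ω) {μ : Measure E}
    (hinv : X.IsInvariant μ) {g : E → ℝ} (hg : Measurable g) (t : ℝ≥0) :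
    ∫ ω, g (X.path t ω) ∂(X.law μ) = ∫ x, g x ∂μ := by
  conv_rhs => rw [← X.law_map_path hinv t]
  rw [integral_map (X.measurable_path_apply t).aemeasurable hg.aestronglyMeasurable]

lemma integral_law_path_mul_path (X : MarkovProcess E Ω) {μ : Measure E} [IsProbabilityMeasure μ]
    (hinv : X.IsInvariant μ) {g : E → ℝ} (hg : Measurable g) {M : ℝ} (hM : ∀ x, |g x| ≤ M)
    (s v : ℝ≥0) :
    ∫ ω, g (X.path s ω) * g (X.path (s + v) ω) ∂(X.law μ) =
      ∫ x, g x * X.semigroup v g x ∂μ := by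
  have hG : Measurable fun z : E × E => g z.1 * g z.2 :=
    (hg.comp measurable_fst).mul (hg.comp measurable_snd)
  have h := integral_map (μ := X.law μ) (φ := fun ω => (X.path s ω, X.path (s + v) ω))
    ((X.measurable_path_apply s).prodMk (X.measurable_path_apply _)).aemeasurable
    hG.aestronglyMeasurable
  rw [← h, X.law_map_pair hinv, Measure.integral_compProd]
  · simp_rw [integral_const_mul, X.semigroup_eq_integral _ hg]
  · refine integrable_of_abs_le hG (M := M * M) fun z => ?_
    rw [abs_mul]
    exact mul_le_mul (hM _) (hM _) (abs_nonneg _) ((abs_nonneg _).trans (hM z.1))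

lemma measurable_path_real (X : MarkovProcess E Ω) :
    Measurable fun z : ℝ × Ω => X.path z.1.toNNReal z.2 :=
  X.measurable_path.comp (by fun_prop : Measurable fun z : ℝ × Ω => (z.1.toNNReal, z.2))

/-- The correlation depends only on `|t - s|`. Splitting the time interval at `s` gives lags running
over `[0, s]` and over `[0, T - s]`. -/
lemma setIntegral_correlation (X : MarkovProcess E Ω) {μ : Measure E} [IsProbabilityMeasure μ]
    (hinv : X.IsInvariant μ) {g : E → ℝ} (hg : Measurable g) {M : ℝ} (hM : ∀ x, |g x| ≤ M)
    {T s : ℝ} (hs : s ∈ Set.Icc 0 T) :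
    ∫ t in Set.Icc (0 : ℝ) T, ∫ ω, g (X.path s.toNNReal ω) * g (X.path t.toNNReal ω) ∂(X.law μ) =
      ∫ x, g x * X.integratedSemigroup s g x ∂μ +
        ∫ x, g x * X.integratedSemigroup (T - s) g x ∂μ := by
  set F : ℝ → ℝ := fun t =>
    ∫ ω, g (X.path s.toNNReal ω) * g (X.path t.toNNReal ω) ∂(X.law μ) with hF
  have hFm : Measurable F := by
    have h : StronglyMeasurable fun z : ℝ × Ω =>
        g (X.path s.toNNReal z.2) * g (X.path z.1.toNNReal z.2) :=
      ((hg.comp ((X.measurable_path_apply _).comp measurable_snd)).mul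
        (hg.comp X.measurable_path_real)).stronglyMeasurable
    exact h.integral_prod_right.measurable
  have hFb (t : ℝ) : |F t| ≤ M * M := by
    have := norm_integral_le_of_norm_le_const (μ := X.law μ)
      (f := fun ω => g (X.path s.toNNReal ω) * g (X.path t.toNNReal ω))
      (C := M * M) (ae_of_all _ fun ω => by
        rw [norm_mul]
        exact mul_le_mul (hM _) (hM _) (abs_nonneg _)
          ((abs_nonneg _).trans (hM (X.path s.toNNReal ω))))
    simpa using this
  have hI (a b : ℝ) : IntervalIntegrable F volume a b := by
    rw [intervalIntegrable_iff]
    have : IsFiniteMeasure ((volume : Measure ℝ).restrict (Set.uIoc a b)) := ⟨by simp [Set.uIoc]⟩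
    exact integrable_of_abs_le hFm hFb
  rw [integral_Icc_eq_integral_Ioc, ← intervalIntegral.integral_of_le (hs.1.trans hs.2),
    ← intervalIntegral.integral_add_adjacent_intervals (hI 0 s) (hI s T),
    X.integral_integratedSemigroup_mul hg hM hg hM, X.integral_integratedSemigroup_mul hg hM hg hM]
  congr 1
  · have h2 := intervalIntegral.integral_comp_sub_left (a := 0) (b := s)
      (fun v : ℝ => ∫ x, g x * X.semigroup v.toNNReal g x ∂μ) s
    rw [sub_self, sub_zero] at h2
    rw [← h2]
    refine intervalIntegral.integral_congr fun t ht => ?_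
    rw [Set.uIcc_of_le hs.1] at ht
    simp only [hF]
    rw [← X.integral_law_path_mul_path hinv hg hM t.toNNReal, ← Real.toNNReal_add ht.1
      (sub_nonneg.2 ht.2), add_sub_cancel]
    simp_rw [mul_comm]
  · have h2 := intervalIntegral.integral_comp_sub_right (a := s) (b := T)
      (fun v : ℝ => ∫ x, g x * X.semigroup v.toNNReal g x ∂μ) s
    rw [sub_self] at h2
    rw [← h2]
    refine intervalIntegral.integral_congr fun t ht => ?_
    rw [Set.uIcc_of_le hs.2] at ht
    simp only [hF]
    rw [← X.integral_law_path_mul_path hinv hg hM s.toNNReal, ← Real.toNNReal_add hs.1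
      (sub_nonneg.2 ht.1), add_sub_cancel]

lemma measurable_timeIntegral (X : MarkovProcess E Ω) {g : E → ℝ} (hg : Measurable g) (T : ℝ) :
    Measurable fun ω => ∫ t in Set.Icc (0 : ℝ) T, g (X.path t.toNNReal ω) := by
  have h : StronglyMeasurable fun z : Ω × ℝ => g (X.path z.2.toNNReal z.1) :=
    (hg.comp (X.measurable_path_real.comp measurable_swap)).stronglyMeasurable
  exact h.integral_prod_right.measurable

lemma abs_timeIntegral_le (X : MarkovProcess E Ω) {g : E → ℝ} {M : ℝ} (hM : ∀ x, |g x| ≤ M)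
    {T : ℝ} (hT : 0 ≤ T) (ω : Ω) :
    |∫ t in Set.Icc (0 : ℝ) T, g (X.path t.toNNReal ω)| ≤ M * T := by
  have := norm_setIntegral_le_of_norm_le_const (μ := volume) (s := Set.Icc (0 : ℝ) T)
    (f := fun t : ℝ => g (X.path t.toNNReal ω)) (C := M) (by simp) (fun t _ => hM _)
  simpa [hT] using this

lemma integral_sq_timeIntegral_le (X : MarkovProcess E Ω) {μ : Measure E}
    [IsProbabilityMeasure μ] (hinv : X.IsInvariant μ) (hcont : X.StronglyContinuousL2 μ)
    {lam : ℝ} (hlam : 0 < lam) (hH2 : X.IteratedPoincare μ lam) {g : E → ℝ} (hg : Measurable g)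
    {M : ℝ} (hM : ∀ x, |g x| ≤ M) (hg0 : ∫ x, g x ∂μ = 0) {T : ℝ} (hT : 0 ≤ T) :
    ∫ ω, (∫ t in Set.Icc (0 : ℝ) T, g (X.path t.toNNReal ω)) ^ 2 ∂(X.law μ) ≤
      4 / lam * (∫ x, g x ^ 2 ∂μ) * T := by
  set ν : Measure ℝ := volume.restrict (Set.Icc (0 : ℝ) T) with hν
  have hG : Measurable fun z : Ω × (ℝ × ℝ) =>
      g (X.path z.2.1.toNNReal z.1) * g (X.path z.2.2.toNNReal z.1) := by
    have m1 : Measurable fun z : Ω × (ℝ × ℝ) => (z.2.1, z.1) := by fun_prop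
    have m2 : Measurable fun z : Ω × (ℝ × ℝ) => (z.2.2, z.1) := by fun_prop
    exact (hg.comp (X.measurable_path_real.comp m1)).mul (hg.comp (X.measurable_path_real.comp m2))
  have hGb (z : Ω × (ℝ × ℝ)) :
      |g (X.path z.2.1.toNNReal z.1) * g (X.path z.2.2.toNNReal z.1)| ≤ M * M := by
    rw [abs_mul]
    exact mul_le_mul (hM _) (hM _) (abs_nonneg _)
      ((abs_nonneg _).trans (hM (X.path z.2.1.toNNReal z.1)))
  have h1 : ∫ ω, (∫ t, g (X.path t.toNNReal ω) ∂ν) ^ 2 ∂(X.law μ) =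
      ∫ s, ∫ t, ∫ ω, g (X.path s.toNNReal ω) * g (X.path t.toNNReal ω) ∂(X.law μ) ∂ν ∂ν := by
    -- The square of a time integral is a double time integral; Fubini moves the expectation inside.
    simp_rw [sq, ← integral_prod_mul]
    rw [integral_integral_swap (f := fun ω (z : ℝ × ℝ) =>
      g (X.path z.1.toNNReal ω) * g (X.path z.2.toNNReal ω)) (integrable_of_abs_le hG hGb),
      integral_prod]
    exact (integrable_of_abs_le (ν := (X.law μ).prod (ν.prod ν)) hG hGb).integral_prod_right
  rw [h1]
  have h2 (s : ℝ) (hs : s ∈ Set.Icc 0 T) :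
      ∫ t, ∫ ω, g (X.path s.toNNReal ω) * g (X.path t.toNNReal ω) ∂(X.law μ) ∂ν ≤
        4 / lam * (∫ x, g x ^ 2 ∂μ) := by
    rw [hν, X.setIntegral_correlation hinv hg hM hs]
    have e1 := X.integral_mul_integratedSemigroup_le hinv hcont hlam hH2 hg hM hg0 ⟨s, hs.1⟩
    have e2 := X.integral_mul_integratedSemigroup_le hinv hcont hlam hH2 hg hM hg0
      ⟨T - s, sub_nonneg.2 hs.2⟩
    refine (add_le_add e1 e2).trans_eq (by ring)
  have h3 := setIntegral_mono_on (μ := volume) (s := Set.Icc (0 : ℝ) T)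
    (f := fun s => ∫ t, ∫ ω, g (X.path s.toNNReal ω) * g (X.path t.toNNReal ω) ∂(X.law μ) ∂ν)
    (g := fun _ => 4 / lam * (∫ x, g x ^ 2 ∂μ)) ?_ (integrableOn_const (by simp)) measurableSet_Icc h2
  · refine h3.trans_eq ?_
    simp [hT, mul_comm]
  · exact (integrable_of_abs_le (ν := (X.law μ).prod (ν.prod ν)) hG
      hGb).integral_prod_right.integral_prod_left


/-! ### Deviation of the empirical measure on a set -/

lemma isProbabilityMeasure_inv_smul_restrict_Icc {T : ℝ} (hT : 0 < T) :
    IsProbabilityMeasure (ENNReal.ofReal T⁻¹ • (volume : Measure ℝ).restrict (Set.Icc 0 T)) :=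
  ⟨by simp [← ENNReal.ofReal_mul (inv_nonneg.2 hT.le), inv_mul_cancel₀ hT.ne']⟩

lemma measurable_path_time (X : MarkovProcess E Ω) (ω : Ω) :
    Measurable fun t : ℝ => X.path t.toNNReal ω :=
  X.measurable_path_real.comp measurable_prodMk_right

lemma isProbabilityMeasure_empiricalMeasure (X : MarkovProcess E Ω) {T : ℝ} (hT : 0 < T) (ω : Ω) :
    IsProbabilityMeasure (X.empiricalMeasure T ω) := by
  have := isProbabilityMeasure_inv_smul_restrict_Icc hT
  rw [empiricalMeasure, ← Measure.map_smul]
  exact Measure.isProbabilityMeasure_map (X.measurable_path_time ω).aemeasurable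

lemma empiricalMeasure_toReal (X : MarkovProcess E Ω) {T : ℝ} (hT : 0 < T) (ω : Ω) {A : Set E}
    (hA : MeasurableSet A) : (X.empiricalMeasure T ω A).toReal =
      T⁻¹ * ∫ t in Set.Icc (0 : ℝ) T, A.indicator (fun _ => (1 : ℝ)) (X.path t.toNNReal ω) := by
  have hpre : MeasurableSet ((fun t : ℝ => X.path t.toNNReal ω) ⁻¹' A) :=
    X.measurable_path_time ω hA
  have h : ∀ t : ℝ, A.indicator (fun _ => (1 : ℝ)) (X.path t.toNNReal ω) =
      ((fun t : ℝ => X.path t.toNNReal ω) ⁻¹' A).indicator (fun _ => (1 : ℝ)) t := fun t => rfl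
  simp_rw [h]
  rw [integral_indicator_const _ hpre, empiricalMeasure, Measure.smul_apply, smul_eq_mul,
    ENNReal.toReal_mul, ENNReal.toReal_ofReal (inv_nonneg.2 hT.le),
    Measure.map_apply (X.measurable_path_time ω) hA]
  simp [measureReal_def]

lemma measurable_empiricalMeasure_apply (X : MarkovProcess E Ω) {T : ℝ} (hT : 0 < T) {A : Set E}
    (hA : MeasurableSet A) : Measurable fun ω => X.empiricalMeasure T ω A := by
  have h : (fun ω => X.empiricalMeasure T ω A) = fun ω => ENNReal.ofReal (T⁻¹ *
      ∫ t in Set.Icc (0 : ℝ) T, A.indicator (fun _ => (1 : ℝ)) (X.path t.toNNReal ω)) := by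
    ext ω
    have := X.isProbabilityMeasure_empiricalMeasure hT ω
    rw [← X.empiricalMeasure_toReal hT _ hA, ENNReal.ofReal_toReal (measure_ne_top _ _)]
  rw [h]
  exact ((X.measurable_timeIntegral (measurable_const.indicator hA) T).const_mul _).ennreal_ofReal

/-- The mean deviation of the empirical measure on a set, interpolated between the trivial bound
and the variance bound. -/
lemma lintegral_empiricalMeasure_deviation_le (X : MarkovProcess E Ω) {μ : Measure E}
    [IsProbabilityMeasure μ] (hinv : X.IsInvariant μ) (hcont : X.StronglyContinuousL2 μ)
    {lam : ℝ} (hlam : 0 < lam) (hH2 : X.IteratedPoincare μ lam) {A : Set E}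
    (hA : MeasurableSet A) {T : ℝ} (hT : 0 < T) {a : ℝ} (ha : 0 ≤ a) (ha2 : 2 * a ≤ 1) :
    ∫⁻ ω, ((X.empiricalMeasure T ω A - μ A) + (μ A - X.empiricalMeasure T ω A)) ∂(X.law μ) ≤
      ENNReal.ofReal (2 * (1 + 4 / lam) * T ^ (-a)) * μ A ^ (1 - a) := by
  set m : ℝ := (μ A).toReal with hm
  have hm0 : 0 ≤ m := ENNReal.toReal_nonneg
  have hm1 : m ≤ 1 := by
    have := ENNReal.toReal_mono ENNReal.one_ne_top (prob_le_one (μ := μ) (s := A))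
    simpa using this
  set f : E → ℝ := A.indicator (fun _ => (1 : ℝ)) with hf
  have hfm : Measurable f := measurable_const.indicator hA
  have hf01 (x : E) : f x = 0 ∨ f x = 1 := by
    by_cases h : x ∈ A <;> simp [hf, h]
  have hfb (x : E) : |f x| ≤ 1 := by rcases hf01 x with h | h <;> simp [h]
  have hfint : ∫ x, f x ∂μ = m := by
    rw [hf, integral_indicator_const _ hA, smul_eq_mul, mul_one]; rfl
  set g : E → ℝ := fun x => f x - m with hg
  have hgm : Measurable g := hfm.sub_const m
  have hgb (x : E) : |g x| ≤ 1 := by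
    rcases hf01 x with h | h <;> simp only [hg, h] <;> rw [abs_le] <;> constructor <;> linarith
  have hfi : Integrable f μ := integrable_of_abs_le hfm hfb
  have hg0 : ∫ x, g x ∂μ = 0 := by
    rw [hg, integral_sub hfi (integrable_const _), hfint]; simp
  have hg2 : ∫ x, g x ^ 2 ∂μ ≤ m := by
    -- Since `f² = f`, the square is affine in `f` and integrates to `m - m² ≤ m`.
    have h (x : E) : g x ^ 2 = (1 - 2 * m) * f x + m ^ 2 := by
      rcases hf01 x with h | h <;> simp only [hg, h] <;> ring
    simp_rw [h]
    rw [integral_add (hfi.const_mul _) (integrable_const _), integral_const_mul, hfint]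
    simp
    nlinarith
  set G : Ω → ℝ := fun ω => ∫ t in Set.Icc (0 : ℝ) T, g (X.path t.toNNReal ω) with hG
  set F : Ω → ℝ := fun ω => ∫ t in Set.Icc (0 : ℝ) T, f (X.path t.toNNReal ω) with hF
  have hGm : Measurable G := X.measurable_timeIntegral hgm T
  have hFm : Measurable F := X.measurable_timeIntegral hfm T
  have hGb : ∀ ω, |G ω| ≤ 1 * T := X.abs_timeIntegral_le hgb hT.le
  have hFb : ∀ ω, |F ω| ≤ 1 * T := X.abs_timeIntegral_le hfb hT.le
  have hGF (ω : Ω) : G ω = F ω - T * m := by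
    simp only [hG, hF, hg]
    rw [integral_sub]
    · simp [hT.le]
    · exact integrable_of_abs_le (hfm.comp (X.measurable_path_time ω)) fun t => hfb _
    · exact integrableOn_const (by simp)
  have hF0 (ω : Ω) : 0 ≤ F ω := integral_nonneg fun t => by
    rcases hf01 (X.path t.toNNReal ω) with h | h <;> simp [h]
  have hFint : ∫ ω, F ω ∂(X.law μ) = T * m := by
    simp only [hF]
    rw [integral_integral_swap (f := fun ω (t : ℝ) => f (X.path t.toNNReal ω))
      (integrable_of_abs_le (hfm.comp (X.measurable_path_real.comp measurable_swap))
        fun z => hfb _)]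
    simp [X.integral_law_path hinv hfm, hfint, hT.le]
  set D : ℝ := ∫ ω, |G ω| ∂(X.law μ) with hD
  have hD0 : 0 ≤ D := integral_nonneg fun ω => abs_nonneg _
  have hD1 : D ≤ T * (2 * m) := by
    have h1 : ∀ ω, |G ω| ≤ F ω + T * m := fun ω => by
      rw [hGF, abs_le]
      have := hF0 ω
      have : 0 ≤ T * m := by positivity
      constructor <;> linarith
    have hFi : Integrable F (X.law μ) := integrable_of_abs_le hFm hFb
    have := integral_mono (integrable_of_abs_le hGm hGb).abs (hFi.add (integrable_const (T * m))) h1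
    simp only [Pi.add_apply] at this
    rw [integral_add hFi (integrable_const _), hFint] at this
    simp at this
    linarith
  have hD2 : D ^ 2 ≤ T ^ 2 * (4 / lam * m / T) := by
    refine (sq_integral_abs_le hGm hGb).trans ((X.integral_sq_timeIntegral_le hinv hcont hlam hH2
      hgm hgb hg0 hT.le).trans ?_)
    calc _ ≤ 4 / lam * m * T := by gcongr
      _ = _ := by field_simp
  set d : ℝ := T⁻¹ * D with hd
  have hd0 : 0 ≤ d := by positivity
  have hd1 : d ≤ 2 * m := by
    rw [hd, inv_mul_le_iff₀ hT]; exact hD1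
  have hd2 : d ^ 2 ≤ 4 / lam * m / T := by
    rw [hd, mul_pow, inv_pow, inv_mul_le_iff₀ (by positivity)]; exact hD2
  have hdm : d ≤ 2 * (1 + 4 / lam) * T ^ (-a) * m ^ (1 - a) := by
    -- The first factor takes the trivial bound `hd1`, the second the variance bound `hd2`. The
    -- condition `2a ≤ 1` keeps the exponent `1 - 2a` nonnegative.
    have e1 : d = d ^ (1 - 2 * a) * (d ^ 2) ^ a := by
      rw [← Real.rpow_natCast, ← Real.rpow_mul hd0, ← Real.rpow_add_of_nonneg hd0 (by linarith)
        (by positivity)]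
      simp
    have h4 : (2 : ℝ) ^ (1 - 2 * a) ≤ 2 := by
      conv_rhs => rw [← Real.rpow_one 2]
      exact Real.rpow_le_rpow_of_exponent_le (by norm_num) (by linarith)
    have h5 : (4 / lam) ^ a ≤ 1 + 4 / lam := by
      have hpos : 0 < 4 / lam := by positivity
      calc (4 / lam) ^ a ≤ (1 + 4 / lam) ^ a := by gcongr; linarith
        _ ≤ (1 + 4 / lam) ^ (1 : ℝ) :=
          Real.rpow_le_rpow_of_exponent_le (by linarith) (by linarith)
        _ = _ := Real.rpow_one _
    calc d = d ^ (1 - 2 * a) * (d ^ 2) ^ a := e1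
      _ ≤ (2 * m) ^ (1 - 2 * a) * (4 / lam * m / T) ^ a := by
          gcongr
      _ = 2 ^ (1 - 2 * a) * (4 / lam) ^ a * T ^ (-a) * (m ^ (1 - 2 * a) * m ^ a) := by
          rw [Real.mul_rpow (by norm_num) hm0, Real.div_rpow (by positivity) hT.le,
            Real.mul_rpow (by positivity) hm0, Real.rpow_neg hT.le]
          ring
      _ = 2 ^ (1 - 2 * a) * (4 / lam) ^ a * T ^ (-a) * m ^ (1 - a) := by
          rw [← Real.rpow_add_of_nonneg hm0 (by linarith) ha]
          ring_nf
      _ ≤ _ := by gcongr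
  have hfin (ω : Ω) : X.empiricalMeasure T ω A ≠ ∞ := by
    have := X.isProbabilityMeasure_empiricalMeasure hT ω
    exact measure_ne_top _ _
  calc ∫⁻ ω, ((X.empiricalMeasure T ω A - μ A) + (μ A - X.empiricalMeasure T ω A)) ∂(X.law μ)
      = ∫⁻ ω, ENNReal.ofReal (T⁻¹ * |G ω|) ∂(X.law μ) := by
        refine lintegral_congr fun ω => ?_
        rw [ENNReal.sub_add_sub_eq_ofReal_abs (hfin ω) (measure_ne_top _ _),
          X.empiricalMeasure_toReal hT ω hA, ← hm, hGF]
        congr 1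
        rw [← abs_of_pos (inv_pos.2 hT), ← abs_mul, abs_of_pos (inv_pos.2 hT), mul_sub,
          inv_mul_cancel_left₀ hT.ne']
    _ = ENNReal.ofReal d := by
        rw [← ofReal_integral_eq_lintegral_ofReal
          ((integrable_of_abs_le hGm hGb).abs.const_mul _) (ae_of_all _ fun ω => by positivity),
          integral_const_mul]
    _ ≤ ENNReal.ofReal (2 * (1 + 4 / lam) * T ^ (-a) * m ^ (1 - a)) := ENNReal.ofReal_le_ofReal hdm
    _ = _ := by
        rw [ENNReal.ofReal_mul (by positivity), ← ENNReal.ofReal_rpow_of_nonneg hm0 (by linarith),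
          hm, ENNReal.ofReal_toReal (measure_ne_top _ _)]

end MarkovProcess

/-! ### Dyadic shells and cells -/

/-- The index `n` of the dyadic shell `2^(n-1) ≤ ‖x‖ < 2^n` (`‖x‖ < 1` for `n = 0`). -/
def dyadicShell {E : Type*} [NormedAddCommGroup E] (x : E) : ℕ := Nat.size ⌊‖x‖⌋₊

/-- The dyadic cell of level `l` of a point: its shell `n` and its cube of side length
`2^(n-l)`. -/
def dyadicCell {d : ℕ} (l : ℕ) (x : EuclideanSpace ℝ (Fin d)) : ℕ × (Fin d → ℤ) :=
  (dyadicShell x, fun i => ⌊(2 : ℝ) ^ l * (x i / 2 ^ dyadicShell x)⌋)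

/-- An upper bound for the transport cost inside a dyadic cell of level `l`. -/
def cellWeight (p : ℝ) {d : ℕ} (l : ℕ) (i : ℕ × (Fin d → ℤ)) : ℝ≥0∞ :=
  ENNReal.ofReal ((2 + d : ℝ) ^ p * 2 ^ (p * (i.1 - l)))

section Shell

variable {E : Type*} [NormedAddCommGroup E]

lemma norm_lt_two_pow_dyadicShell (x : E) : ‖x‖ < 2 ^ dyadicShell x := by
  have h : ⌊‖x‖⌋₊ < 2 ^ dyadicShell x := Nat.lt_size_self _
  have := (Nat.floor_lt (norm_nonneg x)).1 h
  exact_mod_cast this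

lemma two_pow_le_two_mul_norm {x : E} (h : dyadicShell x ≠ 0) :
    (2 : ℝ) ^ dyadicShell x ≤ 2 * ‖x‖ := by
  obtain ⟨n, hn⟩ := Nat.exists_eq_succ_of_ne_zero h
  have h1 : 2 ^ n ≤ ⌊‖x‖⌋₊ := by
    refine Nat.lt_size.1 ?_
    have : Nat.size ⌊‖x‖⌋₊ = n + 1 := hn
    omega
  have h2 := (Nat.le_floor_iff (norm_nonneg x)).1 h1
  push_cast at h2
  rw [hn, pow_succ]
  linarith

lemma measurable_dyadicShell [MeasurableSpace E] [OpensMeasurableSpace E] :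
    Measurable (dyadicShell : E → ℕ) :=
  (measurable_of_countable Nat.size).comp (Nat.measurable_floor.comp measurable_norm)

/-- Markov's inequality in pointwise form. The summand `1` serves the innermost shell, which comes
with no lower bound on `‖x‖`. -/
lemma measure_dyadicShell_le [MeasurableSpace E] [OpensMeasurableSpace E] {μ : Measure E}
    [IsProbabilityMeasure μ] {q : ℝ} (hq : 0 < q) (hint : Integrable (fun x => ‖x‖ ^ q) μ) (n : ℕ) :
    μ (dyadicShell ⁻¹' {n}) ≤
      ENNReal.ofReal ((1 + 2 ^ q * ∫ x, ‖x‖ ^ q ∂μ) * 2 ^ (-(q * n))) := by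
  have hB : MeasurableSet (dyadicShell ⁻¹' {n} : Set E) :=
    measurable_dyadicShell (measurableSet_singleton n)
  have hfin : μ (dyadicShell ⁻¹' {n}) ≠ ∞ := measure_ne_top _ _
  rw [← ENNReal.ofReal_toReal hfin]
  refine ENNReal.ofReal_le_ofReal ?_
  have h1 : (μ (dyadicShell ⁻¹' {n})).toReal =
      ∫ x, (dyadicShell ⁻¹' {n} : Set E).indicator (fun _ => (1 : ℝ)) x ∂μ := by
    rw [integral_indicator_const _ hB, smul_eq_mul, mul_one]; rfl
  have hi2 : Integrable (fun x : E => (1 + 2 ^ q * ‖x‖ ^ q) * 2 ^ (-(q * n))) μ :=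
    ((integrable_const _).add (hint.const_mul _)).mul_const _
  rw [h1]
  refine (integral_mono ((integrable_const (1 : ℝ)).indicator hB) hi2 fun x => ?_).trans_eq ?_
  · by_cases hx : x ∈ (dyadicShell ⁻¹' {n} : Set E)
    · simp only [Set.indicator_of_mem hx]
      have hx' : dyadicShell x = n := hx
      rw [Real.rpow_neg (by norm_num), ← div_eq_mul_inv, le_div_iff₀ (by positivity), one_mul,
        mul_comm q, Real.rpow_mul (by norm_num), Real.rpow_natCast]
      rcases eq_or_ne n 0 with rfl | hn
      · have : 0 ≤ (2 : ℝ) ^ q * ‖x‖ ^ q := by positivity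
        simpa using this
      · have h2 := two_pow_le_two_mul_norm (hx'.trans_ne hn)
        rw [hx'] at h2
        calc ((2 : ℝ) ^ n) ^ q ≤ (2 * ‖x‖) ^ q := by gcongr
          _ = 2 ^ q * ‖x‖ ^ q := Real.mul_rpow (by norm_num) (norm_nonneg _)
          _ ≤ _ := by linarith
    · simp only [Set.indicator_of_notMem hx]
      positivity
  · rw [integral_mul_const, integral_add (integrable_const _) (hint.const_mul _),
      integral_const_mul]
    simp

end Shell

variable {d : ℕ}

lemma measurable_dyadicCell (l : ℕ) :
    Measurable (dyadicCell l : EuclideanSpace ℝ (Fin d) → ℕ × (Fin d → ℤ)) := by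
  refine measurable_dyadicShell.prodMk (measurable_pi_iff.2 fun i => Int.measurable_floor.comp ?_)
  have h1 : Measurable fun x : EuclideanSpace ℝ (Fin d) => (2 : ℝ) ^ dyadicShell x :=
    (measurable_of_countable fun n : ℕ => (2 : ℝ) ^ n).comp measurable_dyadicShell
  have h2 : Measurable fun x : EuclideanSpace ℝ (Fin d) => x i := by fun_prop
  exact (h2.div h1).const_mul _

/-- The dyadic interval of `u` is determined by its half containing `u`; this makes each level
refine the one before. -/
lemma floor_eq_floor_of_floor_two_mul_eq {u v : ℝ} (h : ⌊2 * u⌋ = ⌊2 * v⌋) : ⌊u⌋ = ⌊v⌋ := by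
  have key {u v : ℝ} (h : ⌊2 * u⌋ = ⌊2 * v⌋) : ⌊u⌋ ≤ ⌊v⌋ := by
    rw [Int.le_floor]
    have h1 : 2 * ⌊u⌋ ≤ ⌊2 * u⌋ := by
      rw [Int.le_floor]
      push_cast
      linarith [Int.floor_le u]
    rw [h, Int.le_floor] at h1
    push_cast at h1
    linarith
  exact le_antisymm (key h) (key h.symm)

lemma dyadicCell_eq_of_succ {l : ℕ} {x y : EuclideanSpace ℝ (Fin d)}
    (h : dyadicCell (l + 1) x = dyadicCell (l + 1) y) : dyadicCell l x = dyadicCell l y := by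
  have h1 : dyadicShell x = dyadicShell y := congrArg Prod.fst h
  refine Prod.ext h1 (funext fun i => ?_)
  have h2 := congrFun (congrArg Prod.snd h) i
  simp only [dyadicCell, pow_succ', mul_assoc] at h2 ⊢
  exact floor_eq_floor_of_floor_two_mul_eq h2

lemma norm_le_card_mul {x : EuclideanSpace ℝ (Fin d)} {b : ℝ} (hb : 0 ≤ b)
    (h : ∀ i, |x i| ≤ b) : ‖x‖ ≤ d * b := by
  rw [EuclideanSpace.norm_eq]
  refine Real.sqrt_le_iff.2 ⟨by positivity, ?_⟩
  calc ∑ i, ‖x i‖ ^ 2 ≤ ∑ _i : Fin d, b ^ 2 := by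
        refine Finset.sum_le_sum fun i _ => ?_
        exact pow_le_pow_left₀ (norm_nonneg _) (h i) 2
    _ = d * b ^ 2 := by simp
    _ ≤ (d * d : ℝ) * b ^ 2 := by
        gcongr
        exact_mod_cast Nat.le_mul_self d
    _ = _ := by ring

lemma ofReal_rpow_le_cellWeight {p : ℝ} (hp : 0 < p) (l : ℕ) {x y : EuclideanSpace ℝ (Fin d)}
    (h : dyadicCell l x = dyadicCell l y) :
    ENNReal.ofReal (‖x - y‖ ^ p) ≤ cellWeight p l (dyadicCell l x) := by
  refine ENNReal.ofReal_le_ofReal ?_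
  have h1 : dyadicShell x = dyadicShell y := congrArg Prod.fst h
  set n := dyadicShell x with hn
  have hpos : (0 : ℝ) < 2 ^ ((n : ℝ) - l) := by positivity
  have hco (i : Fin d) : |(x - y) i| ≤ 2 ^ ((n : ℝ) - l) := by
    have h2 : ⌊(2 : ℝ) ^ l * (x i / 2 ^ n)⌋ = ⌊(2 : ℝ) ^ l * (y i / 2 ^ n)⌋ := by
      have := congrFun (congrArg Prod.snd h) i
      simp only [dyadicCell, ← h1, ← hn] at this
      exact this
    have h3 := Int.abs_sub_lt_one_of_floor_eq_floor h2
    rw [Real.rpow_sub (by norm_num), Real.rpow_natCast, Real.rpow_natCast, le_div_iff₀ (by positivity)]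
    have h4 : (2 : ℝ) ^ l * (x i / 2 ^ n) - 2 ^ l * (y i / 2 ^ n) = (x i - y i) * 2 ^ l / 2 ^ n := by
      ring
    rw [h4, abs_div, abs_mul, abs_of_pos (by positivity : (0 : ℝ) < 2 ^ l),
      abs_of_pos (by positivity : (0 : ℝ) < 2 ^ n), div_lt_one (by positivity)] at h3
    exact h3.le
  have hnorm := norm_le_card_mul hpos.le hco
  calc ‖x - y‖ ^ p ≤ ((2 + d : ℝ) * 2 ^ ((n : ℝ) - l)) ^ p := by
        gcongr
        refine hnorm.trans ?_
        gcongr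
        linarith
    _ = (2 + d : ℝ) ^ p * 2 ^ (p * ((n : ℝ) - l)) := by
        rw [Real.mul_rpow (by positivity) hpos.le, ← Real.rpow_mul (by norm_num), mul_comm p]

lemma cellWeight_succ (p : ℝ) (l : ℕ) (x : EuclideanSpace ℝ (Fin d)) :
    cellWeight p l (dyadicCell l x) =
      ENNReal.ofReal (2 ^ p) * cellWeight p (l + 1) (dyadicCell (l + 1) x) := by
  rw [cellWeight, cellWeight, ← ENNReal.ofReal_mul (by positivity)]
  congr 1
  have : (2 : ℝ) ^ (p * ((dyadicShell x : ℝ) - l)) =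
      2 ^ p * 2 ^ (p * ((dyadicShell x : ℝ) - (l + 1 : ℕ))) := by
    rw [← Real.rpow_add (by norm_num)]
    push_cast
    ring_nf
  simp only [dyadicCell, this]
  ring

/-- Two points are at distance at most `2 · 2^n`, with `n` the larger of their shell indices. This
accounts for the `2` in the constant `2 + d` of `cellWeight`; the `d` comes from the diameter of a
cube. -/
lemma ofReal_rpow_le_cellWeight_add {p : ℝ} (hp : 0 < p) (x y : EuclideanSpace ℝ (Fin d)) :
    ENNReal.ofReal (‖x - y‖ ^ p) ≤
      cellWeight p 0 (dyadicCell 0 x) + cellWeight p 0 (dyadicCell 0 y) := by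
  have key (x y : EuclideanSpace ℝ (Fin d)) (h : dyadicShell y ≤ dyadicShell x) :
      ENNReal.ofReal (‖x - y‖ ^ p) ≤ cellWeight p 0 (dyadicCell 0 x) := by
    refine ENNReal.ofReal_le_ofReal ?_
    have hle : ‖x - y‖ ≤ (2 + d : ℝ) * 2 ^ (dyadicShell x : ℝ) := by
      have h1 := (norm_lt_two_pow_dyadicShell x).le
      have h2 := (norm_lt_two_pow_dyadicShell y).le.trans
        (pow_le_pow_right₀ (by norm_num : (1 : ℝ) ≤ 2) h)
      have h3 : (0 : ℝ) ≤ d * 2 ^ dyadicShell x := by positivity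
      rw [Real.rpow_natCast]
      linarith [norm_sub_le x y]
    calc ‖x - y‖ ^ p ≤ ((2 + d : ℝ) * 2 ^ (dyadicShell x : ℝ)) ^ p := by gcongr
      _ = _ := by
        rw [Real.mul_rpow (by positivity) (by positivity), ← Real.rpow_mul (by norm_num), mul_comm p]
        simp [dyadicCell]
  rcases le_total (dyadicShell y) (dyadicShell x) with h | h
  · exact (key x y h).trans le_self_add
  · rw [norm_sub_rev]
    exact (key y x h).trans le_add_self

lemma transportCost_le_dyadic {p : ℝ} (hp : 0 < p) (ν₀ ν₁ : Measure (EuclideanSpace ℝ (Fin d)))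
    [IsProbabilityMeasure ν₀] [IsProbabilityMeasure ν₁] (L : ℕ) :
    transportCost p ν₀ ν₁ ≤ ∫⁻ x, cellWeight p L (dyadicCell L x) ∂ν₁ +
      ENNReal.ofReal (2 ^ p) * ∑ l ∈ Finset.range (L + 1), ∑' i, cellWeight p l i *
        ((ν₀ (dyadicCell l ⁻¹' {i}) - ν₁ (dyadicCell l ⁻¹' {i})) +
          (ν₁ (dyadicCell l ⁻¹' {i}) - ν₀ (dyadicCell l ⁻¹' {i}))) :=
  transportCost_le_multilevel ν₀ ν₁ p measurable_dyadicCell (fun _ _ _ => dyadicCell_eq_of_succ)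
    (ENNReal.one_le_ofReal.2 (Real.one_le_rpow (by norm_num) hp.le))
    (fun l _ _ => ofReal_rpow_le_cellWeight hp l) (fun l x => (cellWeight_succ p l x).le)
    (ofReal_rpow_le_cellWeight_add hp) L

/-! ### Summing over the cells -/

/-- Hölder against the constant function `1`, with exponents `1/a` and `1/(1-a)`. -/
lemma ENNReal.sum_rpow_one_sub_le {ι : Type*} (s : Finset ι) (f : ι → ℝ≥0∞) {a : ℝ} (ha : 0 < a)
    (ha1 : a < 1) : ∑ i ∈ s, f i ^ (1 - a) ≤ (s.card : ℝ≥0∞) ^ a * (∑ i ∈ s, f i) ^ (1 - a) := by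
  have hpq : (a⁻¹).HolderConjugate (1 - a)⁻¹ := by
    refine Real.holderConjugate_iff.2 ⟨(one_lt_inv₀ ha).2 ha1, ?_⟩
    simp
  have h1a : 1 - a ≠ 0 := by linarith
  have h := ENNReal.inner_le_Lp_mul_Lq s (fun _ => 1) (fun i => f i ^ (1 - a)) hpq
  simpa [← ENNReal.rpow_mul, mul_inv_cancel₀ h1a] using h

lemma snd_dyadicCell_mem (l : ℕ) (x : EuclideanSpace ℝ (Fin d)) :
    (dyadicCell l x).2 ∈ Fintype.piFinset fun _ : Fin d => Finset.Icc (-2 ^ l : ℤ) (2 ^ l) := by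
  rw [Fintype.mem_piFinset]
  intro i
  have h1 : |x i / 2 ^ dyadicShell x| ≤ 1 := by
    rw [abs_div, abs_of_pos (by positivity : (0 : ℝ) < 2 ^ dyadicShell x),
      div_le_one (by positivity)]
    exact (PiLp.norm_apply_le x i).trans (norm_lt_two_pow_dyadicShell x).le
  have h2 := abs_le.1 h1
  have h3 : (0 : ℝ) < 2 ^ l := by positivity
  simp only [dyadicCell, Finset.mem_Icc]
  constructor
  · rw [Int.le_floor]
    push_cast
    nlinarith
  · have h4 : (⌊(2 : ℝ) ^ l * (x i / 2 ^ dyadicShell x)⌋ : ℝ) ≤ 2 ^ l :=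
      (Int.floor_le _).trans (by nlinarith)
    exact_mod_cast h4

lemma card_dyadicBox_le (l : ℕ) :
    ((Fintype.piFinset fun _ : Fin d => Finset.Icc (-2 ^ l : ℤ) (2 ^ l)).card : ℝ) ≤
      3 ^ d * (2 ^ l) ^ d := by
  have h : (Finset.Icc (-2 ^ l : ℤ) (2 ^ l)).card = 2 * 2 ^ l + 1 := by
    rw [Int.card_Icc]
    have : (2 ^ l : ℤ) + 1 - -2 ^ l = ((2 * 2 ^ l + 1 : ℕ) : ℤ) := by push_cast; ring
    rw [this, Int.toNat_natCast]
  rw [Fintype.card_piFinset_const, h]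
  push_cast
  rw [← mul_pow]
  gcongr
  have : (1 : ℝ) ≤ 2 ^ l := one_le_pow₀ (by norm_num)
  linarith

/-- At most `(2 · 2^l + 1)^d ≤ (3 · 2^l)^d` cells of level `l` in a shell are nonempty. Hölder costs
this number to the power `a`, and the cells are disjoint parts of the shell. -/
lemma tsum_measure_dyadicCell_rpow_le (μ : Measure (EuclideanSpace ℝ (Fin d))) {a : ℝ}
    (ha : 0 < a) (ha1 : a < 1) (l n : ℕ) :
    ∑' k : Fin d → ℤ, μ (dyadicCell l ⁻¹' {(n, k)}) ^ (1 - a) ≤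
      ENNReal.ofReal ((3 ^ d * (2 ^ l) ^ d) ^ a) * μ (dyadicShell ⁻¹' {n}) ^ (1 - a) := by
  set s := Fintype.piFinset fun _ : Fin d => Finset.Icc (-2 ^ l : ℤ) (2 ^ l)
  rw [tsum_eq_sum (s := s)]
  · refine (ENNReal.sum_rpow_one_sub_le s _ ha ha1).trans ?_
    gcongr
    · rw [← ENNReal.ofReal_rpow_of_nonneg (by positivity) ha.le]
      gcongr
      rw [← ENNReal.ofReal_natCast]
      exact ENNReal.ofReal_le_ofReal (card_dyadicBox_le l)
    · rw [← measure_biUnion_finset]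
      · refine measure_mono ?_
        simp only [Set.iUnion_subset_iff]
        intro k _ x hx
        exact congrArg Prod.fst hx
      · intro k _ k' _ hkk'
        refine Set.disjoint_left.2 fun x hx hx' => hkk' ?_
        exact congrArg Prod.snd (Eq.trans (Eq.symm hx) hx')
      · exact fun k _ => measurable_dyadicCell l (measurableSet_singleton _)
  · intro k hk
    have : dyadicCell l ⁻¹' {(n, k)} = (∅ : Set (EuclideanSpace ℝ (Fin d))) := by
      refine Set.eq_empty_of_forall_notMem fun x hx => hk ?_
      have h : dyadicCell l x = (n, k) := hx
      have h2 := snd_dyadicCell_mem l x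
      rwa [h] at h2
    rw [this, measure_empty, ENNReal.zero_rpow_of_pos (by linarith)]

lemma two_rpow_neg_lt_one {x : ℝ} (hx : 0 < x) : ENNReal.ofReal ((2 : ℝ) ^ (-x)) < 1 := by
  rw [← ENNReal.ofReal_one]
  exact (ENNReal.ofReal_lt_ofReal_iff one_pos).2
    (Real.rpow_lt_one_of_one_lt_of_neg (by norm_num) (by linarith))

lemma tsum_ofReal_two_rpow_pow_ne_top {x : ℝ} (hx : 0 < x) :
    ∑' n : ℕ, ENNReal.ofReal ((2 : ℝ) ^ (-x)) ^ n ≠ ∞ := by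
  rw [ENNReal.tsum_geometric]
  exact ENNReal.inv_ne_top.2 (tsub_pos_of_lt (two_rpow_neg_lt_one hx)).ne'

section

variable {d : ℕ} {μ : Measure (EuclideanSpace ℝ (Fin d))} [IsProbabilityMeasure μ]

/-- Shell `n` at level `l` contributes at most a constant times `2^{p(n-l)} 2^{lda} 2^{-qn(1-a)}`.
This factors into a geometric term in `n`, summable by `hpq`, and a geometric term in `l`, which is
kept. -/
lemma exists_tsum_cellWeight_mul_le {p q a : ℝ} (hq : 0 < q)
    (hint : Integrable (fun x => ‖x‖ ^ q) μ) (ha : 0 < a) (ha1 : a < 1) (hpq : p < q * (1 - a)) :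
    ∃ W : ℝ≥0∞, W ≠ ∞ ∧ ∀ l : ℕ,
      ∑' i, cellWeight p l i * μ (dyadicCell l ⁻¹' {i}) ^ (1 - a) ≤
        W * ENNReal.ofReal (2 ^ (-(p - d * a))) ^ l := by
  set Q : ℝ := 1 + 2 ^ q * ∫ x, ‖x‖ ^ q ∂μ with hQ
  have hQ0 : 0 ≤ Q := by
    have : 0 ≤ ∫ x, ‖x‖ ^ q ∂μ := integral_nonneg fun x => by positivity
    positivity
  set r := ENNReal.ofReal ((2 : ℝ) ^ (-(q * (1 - a) - p))) with hr
  refine ⟨ENNReal.ofReal ((2 + d : ℝ) ^ p * (3 ^ d) ^ a * Q ^ (1 - a)) * ∑' n : ℕ, r ^ n,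
    ENNReal.mul_ne_top ENNReal.ofReal_ne_top (tsum_ofReal_two_rpow_pow_ne_top (by linarith)),
    fun l => ?_⟩
  rw [ENNReal.tsum_prod', ← ENNReal.tsum_mul_left, ← ENNReal.tsum_mul_right]
  refine ENNReal.tsum_le_tsum fun n => ?_
  have h1a : 0 ≤ 1 - a := by linarith
  calc ∑' k, cellWeight p l (n, k) * μ (dyadicCell l ⁻¹' {(n, k)}) ^ (1 - a)
      = ENNReal.ofReal ((2 + d : ℝ) ^ p * 2 ^ (p * ((n : ℝ) - l))) *
          ∑' k, μ (dyadicCell l ⁻¹' {(n, k)}) ^ (1 - a) := by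
        simp only [cellWeight]
        rw [ENNReal.tsum_mul_left]
    _ ≤ ENNReal.ofReal ((2 + d : ℝ) ^ p * 2 ^ (p * ((n : ℝ) - l))) *
          (ENNReal.ofReal ((3 ^ d * (2 ^ l) ^ d) ^ a) *
            ENNReal.ofReal (Q * 2 ^ (-(q * n))) ^ (1 - a)) := by
        gcongr
        refine (tsum_measure_dyadicCell_rpow_le μ ha ha1 l n).trans ?_
        gcongr
        exact measure_dyadicShell_le hq hint n
    _ = ENNReal.ofReal ((2 + d : ℝ) ^ p * (3 ^ d) ^ a * Q ^ (1 - a)) * r ^ n *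
          ENNReal.ofReal (2 ^ (-(p - d * a))) ^ l := by
        rw [ENNReal.ofReal_rpow_of_nonneg (by positivity) h1a, hr,
          ← ENNReal.ofReal_pow (by positivity), ← ENNReal.ofReal_pow (by positivity),
          ← ENNReal.ofReal_mul (by positivity), ← ENNReal.ofReal_mul (by positivity),
          ← ENNReal.ofReal_mul (by positivity), ← ENNReal.ofReal_mul (by positivity)]
        congr 1
        have e1 : (((2 : ℝ) ^ l) ^ d) ^ a = 2 ^ (l * d * a) := by
          rw [Real.rpow_mul (by norm_num), Real.rpow_mul (by norm_num), Real.rpow_natCast,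
            Real.rpow_natCast]
        have e2 : ((2 : ℝ) ^ (-(q * n))) ^ (1 - a) = 2 ^ (-(q * n) * (1 - a)) :=
          (Real.rpow_mul (by norm_num) _ _).symm
        have e3 (x : ℝ) (m : ℕ) : ((2 : ℝ) ^ x) ^ m = 2 ^ (x * m) := by
          rw [Real.rpow_mul (by norm_num), Real.rpow_natCast]
        have e4 : (2 : ℝ) ^ (p * ((n : ℝ) - l)) * 2 ^ (l * d * a) * 2 ^ (-(q * n) * (1 - a)) =
            2 ^ (-(q * (1 - a) - p) * n) * 2 ^ (-(p - d * a) * l) := by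
          rw [← Real.rpow_add (by norm_num), ← Real.rpow_add (by norm_num),
            ← Real.rpow_add (by norm_num)]
          ring_nf
        rw [Real.mul_rpow (by positivity) (by positivity), Real.mul_rpow hQ0 (by positivity), e1,
          e2, e3, e3]
        linear_combination ((2 + d : ℝ) ^ p * (3 ^ d) ^ a * Q ^ (1 - a)) * e4

/-- The integral is at most `2^{-pL}` times a constant multiple of `∑ 2^{-(q-p)n}`, which is finite
as `p < q`. -/
lemma tendsto_lintegral_cellWeight {p q : ℝ} (hp : 0 < p) (hpq : p < q)
    (hint : Integrable (fun x => ‖x‖ ^ q) μ) :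
    Tendsto (fun L => ∫⁻ x, cellWeight p L (dyadicCell L x) ∂μ) atTop (𝓝 0) := by
  set Q : ℝ := 1 + 2 ^ q * ∫ x, ‖x‖ ^ q ∂μ with hQ
  have hQ0 : 0 ≤ Q := by
    have : 0 ≤ ∫ x, ‖x‖ ^ q ∂μ := integral_nonneg fun x => by positivity
    positivity
  set M : ℝ≥0∞ := ENNReal.ofReal ((2 + d : ℝ) ^ p * Q) *
    ∑' n : ℕ, ENNReal.ofReal ((2 : ℝ) ^ (-(q - p))) ^ n with hM
  have hM' : M ≠ ∞ :=
    ENNReal.mul_ne_top ENNReal.ofReal_ne_top (tsum_ofReal_two_rpow_pow_ne_top (by linarith))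
  have hle (L : ℕ) : ∫⁻ x, cellWeight p L (dyadicCell L x) ∂μ ≤
      ENNReal.ofReal ((2 : ℝ) ^ (-p)) ^ L * M := by
    have h := lintegral_comp_eq_tsum μ measurable_dyadicShell
      (fun n : ℕ => ENNReal.ofReal ((2 + d : ℝ) ^ p * 2 ^ (p * ((n : ℝ) - L))))
    refine (Eq.le h).trans ?_
    rw [hM, ← mul_assoc, ← ENNReal.tsum_mul_left]
    refine ENNReal.tsum_le_tsum fun n => ?_
    refine (mul_le_mul_right (measure_dyadicShell_le (hp.trans hpq) hint n) _).trans_eq ?_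
    rw [← ENNReal.ofReal_pow (by positivity), ← ENNReal.ofReal_pow (by positivity),
      ← ENNReal.ofReal_mul (by positivity), ← ENNReal.ofReal_mul (by positivity),
      ← ENNReal.ofReal_mul (by positivity)]
    congr 1
    have e3 (x : ℝ) (m : ℕ) : ((2 : ℝ) ^ x) ^ m = 2 ^ (x * m) := by
      rw [Real.rpow_mul (by norm_num), Real.rpow_natCast]
    have e4 : (2 : ℝ) ^ (p * ((n : ℝ) - L)) * 2 ^ (-(q * n)) =
        2 ^ (-p * L) * 2 ^ (-(q - p) * n) := by
      rw [← Real.rpow_add (by norm_num), ← Real.rpow_add (by norm_num)]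
      ring_nf
    rw [e3, e3, ← hQ]
    linear_combination ((2 + d : ℝ) ^ p * Q) * e4
  refine tendsto_of_tendsto_of_tendsto_of_le_of_le tendsto_const_nhds ?_ (fun _ => zero_le) hle
  have := ENNReal.Tendsto.mul_const
    (ENNReal.tendsto_pow_atTop_nhds_zero_of_lt_one (two_rpow_neg_lt_one hp)) (b := M)
    (Or.inr hM')
  simpa using this

/-! ### The rate of convergence -/

variable {Ω : Type*} [MeasurableSpace Ω]

/-- The rate of convergence `T^(-a)` for every admissible exponent `a ≤ 1/2` with `a < p/d` and
`a < 1 - p/q`. -/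
theorem MarkovProcess.exists_lintegral_transportCost_le
    (X : MarkovProcess (EuclideanSpace ℝ (Fin d)) Ω)
    (hinv : X.IsInvariant μ) (hcont : X.StronglyContinuousL2 μ)
    (hH2 : ∃ lam : ℝ, 0 < lam ∧ X.IteratedPoincare μ lam)
    {p q a : ℝ} (hp : 0 < p) (hpq : p < q) (hint : Integrable (fun x => ‖x‖ ^ q) μ)
    (ha : 0 < a) (ha2 : 2 * a ≤ 1) (had : d * a < p) (haq : p < q * (1 - a)) :
    ∃ C : ℝ, 0 < C ∧ ∀ T : ℝ, 0 < T →
      ∫⁻ ω, transportCost p (X.empiricalMeasure T ω) μ ∂(X.law μ) ≤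
        ENNReal.ofReal (C * T ^ (-a)) := by
  obtain ⟨lam, hlam, hH⟩ := hH2
  obtain ⟨W, hW, hWle⟩ := exists_tsum_cellWeight_mul_le (μ := μ) (hp.trans hpq) hint ha
    (by linarith) haq
  set G : ℝ≥0∞ := ∑' l : ℕ, ENNReal.ofReal ((2 : ℝ) ^ (-(p - d * a))) ^ l with hG
  have hGtop : G ≠ ∞ := tsum_ofReal_two_rpow_pow_ne_top (by linarith)
  set K : ℝ≥0∞ := ENNReal.ofReal (2 ^ p) * (W * G) with hK
  have hKtop : K ≠ ∞ := ENNReal.mul_ne_top ENNReal.ofReal_ne_top (ENNReal.mul_ne_top hW hGtop)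
  -- The summand `1` makes the constant positive even if `K` vanishes.
  refine ⟨K.toReal * (2 * (1 + 4 / lam)) + 1, by positivity, fun T hT => ?_⟩
  set B : ℝ≥0∞ := ENNReal.ofReal (2 * (1 + 4 / lam) * T ^ (-a)) with hB
  have hcell (l : ℕ) (i : ℕ × (Fin d → ℤ)) :
      MeasurableSet (dyadicCell l ⁻¹' {i} : Set (EuclideanSpace ℝ (Fin d))) :=
    measurable_dyadicCell l (measurableSet_singleton i)
  have hmeas (l : ℕ) (i : ℕ × (Fin d → ℤ)) : Measurable fun ω => cellWeight p l i *
      ((X.empiricalMeasure T ω (dyadicCell l ⁻¹' {i}) - μ (dyadicCell l ⁻¹' {i})) +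
        (μ (dyadicCell l ⁻¹' {i}) - X.empiricalMeasure T ω (dyadicCell l ⁻¹' {i}))) := by
    have := X.measurable_empiricalMeasure_apply hT (hcell l i)
    fun_prop
  have hlevel (l : ℕ) : ∫⁻ ω, ∑' i, cellWeight p l i *
      ((X.empiricalMeasure T ω (dyadicCell l ⁻¹' {i}) - μ (dyadicCell l ⁻¹' {i})) +
        (μ (dyadicCell l ⁻¹' {i}) - X.empiricalMeasure T ω (dyadicCell l ⁻¹' {i}))) ∂(X.law μ) ≤
      B * (W * ENNReal.ofReal (2 ^ (-(p - d * a))) ^ l) := by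
    rw [lintegral_tsum fun i => (hmeas l i).aemeasurable]
    refine le_trans ?_ (mul_le_mul_right (hWle l) B)
    rw [← ENNReal.tsum_mul_left]
    refine ENNReal.tsum_le_tsum fun i => ?_
    rw [lintegral_const_mul' _ _ (show cellWeight p l i ≠ ∞ from ENNReal.ofReal_ne_top)]
    refine (mul_le_mul_right (X.lintegral_empiricalMeasure_deviation_le hinv hcont hlam hH
      (hcell l i) hT ha.le ha2) _).trans_eq ?_
    rw [← hB]
    ring
  have hbound (L : ℕ) : ∫⁻ ω, transportCost p (X.empiricalMeasure T ω) μ ∂(X.law μ) ≤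
      ∫⁻ x, cellWeight p L (dyadicCell L x) ∂μ + B * K := by
    have hpt (ω : Ω) := haveI := X.isProbabilityMeasure_empiricalMeasure hT ω
      transportCost_le_dyadic hp (X.empiricalMeasure T ω) μ L
    refine (lintegral_mono hpt).trans ?_
    rw [lintegral_add_left measurable_const, lintegral_const, measure_univ, mul_one,
      lintegral_const_mul' _ _ ENNReal.ofReal_ne_top,
      lintegral_finsetSum _ fun l _ => Measurable.tsum (hmeas l)]
    refine add_le_add le_rfl ?_
    calc _ ≤ ENNReal.ofReal (2 ^ p) * ∑ l ∈ Finset.range (L + 1),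
          B * (W * ENNReal.ofReal (2 ^ (-(p - d * a))) ^ l) := by
          exact mul_le_mul_right (Finset.sum_le_sum fun l _ => hlevel l) _
      _ = ENNReal.ofReal (2 ^ p) * (B * (W * ∑ l ∈ Finset.range (L + 1),
          ENNReal.ofReal (2 ^ (-(p - d * a))) ^ l)) := by
          rw [← Finset.mul_sum, ← Finset.mul_sum]
      _ ≤ ENNReal.ofReal (2 ^ p) * (B * (W * G)) := by
          gcongr
          exact ENNReal.sum_le_tsum _
      _ = B * K := by rw [hK]; ring
  -- The second term of `hbound` does not depend on the finest level `L`, so `L → ∞` removes the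
  -- first for each fixed `T`.
  have hlim := (tendsto_lintegral_cellWeight (μ := μ) hp hpq hint).add_const (B * K)
  rw [zero_add] at hlim
  refine (ge_of_tendsto' hlim hbound).trans ?_
  rw [hB, ← ENNReal.ofReal_toReal hKtop, ← ENNReal.ofReal_mul (by positivity)]
  refine ENNReal.ofReal_le_ofReal ?_
  have : 0 ≤ T ^ (-a) := by positivity
  rw [ENNReal.toReal_ofReal ENNReal.toReal_nonneg]
  nlinarith

end

end

/-! ### Choice of the exponent and the logarithmic factors -/

theorem theorem1p2 {d : ℕ} (hd : 0 < d) {Ω : Type*} [MeasurableSpace Ω]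
    (X : MarkovProcess (EuclideanSpace ℝ (Fin d)) Ω)
    (μ : Measure (EuclideanSpace ℝ (Fin d))) [IsProbabilityMeasure μ]
    (hinv : X.IsInvariant μ) (herg : X.IsErgodic μ) (hcont : X.StronglyContinuousL2 μ)
    (hH2 : ∃ lam : ℝ, 0 < lam ∧ X.IteratedPoincare μ lam)
    (p q : ℝ) (hp : 0 < p) (hpq : p < q) (hq : Integrable (fun x => ‖x‖ ^ q) μ) :
    (0 < gamma₁ p d ∧ gamma₁ p d < 1) ∧
    ∃ C : ℝ, 0 < C ∧ ∀ T : ℝ, 2 ≤ T →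
      ∫⁻ ω, transportCost p (X.empiricalMeasure T ω) μ ∂(X.law μ) ≤
        ENNReal.ofReal
          (C * T ^ (-(2 / 3 : ℝ) * (1 - max (gamma₁ p d) (p / q))) *
            (if gamma₁ p d * q = p then Real.log T else 1) *
            (if p = 3 / 4 * (d : ℝ) then Real.log T else 1)) ∧
      (4 * p < q →
        (3 / 4 * (d : ℝ) < p →
          ∫⁻ ω, transportCost p (X.empiricalMeasure T ω) μ ∂(X.law μ) ≤
            ENNReal.ofReal (C * T ^ (-(1 / 2 : ℝ)))) ∧
        (p = 3 / 4 * (d : ℝ) →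
          ∫⁻ ω, transportCost p (X.empiricalMeasure T ω) μ ∂(X.law μ) ≤
            ENNReal.ofReal (C * T ^ (-(1 / 2 : ℝ)) * Real.log T)) ∧
        (p < 3 / 4 * (d : ℝ) →
          ∫⁻ ω, transportCost p (X.empiricalMeasure T ω) μ ∂(X.law μ) ≤
            ENNReal.ofReal (C * T ^ (-(2 * p / (3 * (d : ℝ)))))) ) := by
  have hd' : (0 : ℝ) < d := by exact_mod_cast hd
  have hq0 : 0 < q := hp.trans hpq
  have hpd : 0 < p / d := by positivity
  have hγ0 : 1 / 4 ≤ gamma₁ p d := le_max_left _ _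
  have hγd : 1 - p / d ≤ gamma₁ p d := le_max_right _ _
  have hγ1 : gamma₁ p d < 1 := max_lt (by norm_num) (by linarith)
  refine ⟨⟨by linarith, hγ1⟩, ?_⟩
  set m := max (gamma₁ p d) (p / q) with hm
  have hm1 : m < 1 := max_lt hγ1 ((div_lt_one hq0).2 hpq)
  have hmγ : gamma₁ p d ≤ m := le_max_left _ _
  have hmq : p / q ≤ m := le_max_right _ _
  -- From `m ≥ 1/4` comes `a ≤ 1/2`. Since `1 - m` is positive and at most both `p/d` and `1 - p/q`,
  -- the factor `2/3 < 1` makes `a < p/d` and `a < 1 - p/q` strict.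
  obtain ⟨a, ha⟩ : ∃ a : ℝ, a = 2 / 3 * (1 - m) := ⟨_, rfl⟩
  have ha0 : 0 < a := by rw [ha]; linarith
  have had : d * a < p := by
    have : a < p / d := by linarith
    rwa [lt_div_iff₀' hd'] at this
  have haq : p < q * (1 - a) := by
    have : p / q < 1 - a := by linarith
    rwa [div_lt_iff₀' hq0] at this
  obtain ⟨C, hC, hbound⟩ := X.exists_lintegral_transportCost_le hinv hcont hH2 hp hpq hq ha0
    (by linarith) had haq
  have hlog2 : 0 < Real.log 2 := Real.log_pos (by norm_num)
  have hlog2' : Real.log 2 ≤ 1 := by linarith [Real.log_two_lt_d9]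
  -- Each of the two conditional factors is `log T` or `1`, hence at least `log 2`; dividing by `log
  -- 2` squared absorbs both.
  refine ⟨C / Real.log 2 ^ 2, by positivity, fun T hT => ?_⟩
  have hT0 : 0 < T := by linarith
  have hlogT : Real.log 2 ≤ Real.log T := Real.log_le_log (by norm_num) hT
  have hfac (P : Prop) [Decidable P] : Real.log 2 ≤ if P then Real.log T else 1 := by
    split_ifs
    · exact hlogT
    · exact hlog2'
  have hCle : C ≤ C / Real.log 2 ^ 2 := by
    rw [le_div_iff₀ (by positivity)]
    have : Real.log 2 ^ 2 ≤ 1 := pow_le_one₀ hlog2.le hlog2'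
    nlinarith
  have hCle' : C ≤ C / Real.log 2 ^ 2 * Real.log T := by
    have h1 : C / Real.log 2 ^ 2 * Real.log 2 = C / Real.log 2 := by field_simp
    calc C ≤ C / Real.log 2 := le_div_self hC.le hlog2 hlog2'
      _ = C / Real.log 2 ^ 2 * Real.log 2 := h1.symm
      _ ≤ _ := by gcongr
  have hTa : 0 ≤ T ^ (-a) := by positivity
  refine ⟨(hbound T hT0).trans (ENNReal.ofReal_le_ofReal ?_), fun hq4 => ?_⟩
  · rw [show -(2 / 3 : ℝ) * (1 - m) = -a by rw [ha]; ring]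
    have h1 := hfac (gamma₁ p d * q = p)
    have h2 := hfac (p = 3 / 4 * (d : ℝ))
    have h3 : 0 ≤ C / Real.log 2 ^ 2 * T ^ (-a) *
        if gamma₁ p d * q = p then Real.log T else 1 :=
      mul_nonneg (by positivity) (hlog2.le.trans h1)
    calc C * T ^ (-a) = C / Real.log 2 ^ 2 * T ^ (-a) * Real.log 2 * Real.log 2 := by
          field_simp
      _ ≤ _ := by gcongr
  · have hpq4 : p / q < 1 / 4 := by rw [div_lt_iff₀ hq0]; linarith
    have hmeq : m = gamma₁ p d := max_eq_left (by linarith)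
    -- The borderline `p = 3d/4` is where `1 - p/d = 1/4`; beyond it the exponent stays at the
    -- variance rate `1/2`.
    have hlarge (h : 3 / 4 * (d : ℝ) ≤ p) : a = 1 / 2 := by
      have : 3 / 4 ≤ p / d := (le_div_iff₀ hd').2 h
      have hγ : gamma₁ p d = 1 / 4 := max_eq_left (by linarith)
      rw [ha, hmeq, hγ]; norm_num
    refine ⟨fun h => ?_, fun h => ?_, fun h => ?_⟩
    · rw [← hlarge h.le]
      refine (hbound T hT0).trans (ENNReal.ofReal_le_ofReal ?_)
      gcongr
    · rw [← hlarge h.ge]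
      refine (hbound T hT0).trans (ENNReal.ofReal_le_ofReal ?_)
      calc C * T ^ (-a) ≤ C / Real.log 2 ^ 2 * Real.log T * T ^ (-a) := by gcongr
        _ = _ := by ring
    · have hlt : p / d < 3 / 4 := (div_lt_iff₀ hd').2 h
      have hγ : gamma₁ p d = 1 - p / d := max_eq_right (by linarith)
      have haeq : 2 * p / (3 * (d : ℝ)) = a := by
        rw [ha, hmeq, hγ]; field_simp; ring
      rw [haeq]
      refine (hbound T hT0).trans (ENNReal.ofReal_le_ofReal ?_)
      gcongr
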